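/- Let $G$ be any finite directed graph with vertex set $V$ and edge set $E$ (loops and multiple edges allowed), and let $T\subseteq E$ be (the edge set of) a spanning forest of $G$, i.e. a maximal cycle-free spanning subgraph. For every $e\in E\setminus T$ let $\sigma^e\in\{0,\pm1\}^E$ be the sign vector of the unique path in $T$ from the head of $e$ to the tail of $e$ ($+1$ on edges traversed along their orientation, $-1$ on edges traversed against it, $0$ elsewhere), and let $C$ be the $T\times(E\setminus T)$ matrix with columns $\sigma^e|_T$. Define the integral flow polytope and the tension polytope of $G$ by $$F_G=\{f\in\mathbb R^{E\setminus T} : -1\le -Cf\le 1,\ -1\le f\le 1\},\qquad T_G=\{t\in\mathbb R^{T} : -1\le C^{t}t\le 1,\ -1\le t\le 1\}.$$ For $P=F_G$, $n=|E\setminus T|$, and for $P=T_G$, $n=|T|$, there is a polynomial $L_P$, of degree $d=n=\dim P$, with $L_P(k)=|\mathbb Z^n\cap kP|$ for all integers $k\ge 1$ (the Ehrhart polynomial of $P$), and the $h^*$-vector $h^*(P)=(h^*_0,\dots,h^*_d)$ defined by $$(1-z)^{d+1}\sum_{k\ge 0}L_P(k)z^k=\sum_{i=0}^{d}h^*_iz^i$$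 is palindromic: $h^*_i=h^*_{d-i}$ for $0\le i\le d$. -/

import Mathlib

open scoped Pointwise

/-- A directed multigraph with vertex set `V` and edge set `E`; parallel edges and loops are
allowed. -/
structure DirMultigraph (V E : Type*) where
  tail : E → V
  head : E → V

namespace DirMultigraph

variable {V E : Type*} (G : DirMultigraph V E)

/-- A step `(e, true)` traverses the edge `e` along its orientation, a step `(e, false)` traverses
it against its orientation. This is the vertex at which the step starts. -/
def stepSource (s : E × Bool) : V := if s.2 then G.tail s.1 else G.head s.1

/-- The vertex at which a step ends. -/
def stepTarget (s : E × Bool) : V := if s.2 then G.head s.1 else G.tail s.1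

/-- `l` is a walk from `u` to `v` in the underlying undirected graph. -/
def IsWalk : V → List (E × Bool) → V → Prop
  | u, [], v => u = v
  | u, s :: l, v => G.stepSource s = u ∧ IsWalk (G.stepTarget s) l v

/-- `l` is a path from `u` to `v` in the underlying undirected graph: a walk that visits no vertex
twice. -/
def IsPath (u : V) (l : List (E × Bool)) (v : V) : Prop :=
  G.IsWalk u l v ∧ (u :: l.map G.stepTarget).Nodup

/-- `l` is a cycle of the underlying undirected graph: a non-empty closed walk that repeats no edge
and no vertex (except for returning to its start). A loop is a cycle of length one and two parallel
edges form a cycle of length two. -/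
def IsCycle (l : List (E × Bool)) : Prop :=
  l ≠ [] ∧ (∃ u, G.IsWalk u l u) ∧ (l.map Prod.fst).Nodup ∧ (l.map G.stepTarget).Nodup

/-- The spanning subgraph with edge set `S` contains no cycle. -/
def IsCycleFree (S : Finset E) : Prop :=
  ∀ l : List (E × Bool), (∀ s ∈ l, s.1 ∈ S) → ¬ G.IsCycle l

/-- `T` is the edge set of a spanning forest: a maximal cycle-free spanning subgraph. -/
def IsSpanningForest (T : Finset E) : Prop :=
  Maximal G.IsCycleFree T

open Classical in
/-- The path in `T` from `u` to `v`. If `T` is cycle-free and `u`, `v` are connected in `T`, such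
a path exists and is unique; the value is the empty list if there is none. -/
noncomputable def forestPath (T : Finset E) (u v : V) : List (E × Bool) :=
  if h : ∃ l, G.IsPath u l v ∧ ∀ s ∈ l, s.1 ∈ T then h.choose else []

/-- The sign vector of a path: `1` on edges traversed along their orientation, `-1` on edges
traversed against their orientation, `0` on edges not on the path. -/
def signVector [DecidableEq E] (l : List (E × Bool)) (e : E) : ℝ :=
  if (e, true) ∈ l then 1 else if (e, false) ∈ l then -1 else 0

/-- The matrix `C` whose column at a non-forest edge `e` is the restriction to `T` of the sign
vector of the path in `T` from the head of `e` to the tail of `e`. -/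
noncomputable def forestMatrix [DecidableEq E] (T : Finset E) :
    Matrix {e // e ∈ T} {e // e ∉ T} ℝ :=
  Matrix.of fun a e => signVector (G.forestPath T (G.head e.1) (G.tail e.1)) a.1

/-- The tension polytope `{t ∈ ℝ^T | -1 ≤ Cᵀ t ≤ 1, -1 ≤ t ≤ 1}`. -/
def tensionPolytope [DecidableEq E] (T : Finset E) : Set ({e // e ∈ T} → ℝ) :=
  {t | (G.forestMatrix T).transpose.mulVec t ∈ Set.Icc (-1) 1 ∧ t ∈ Set.Icc (-1) 1}

/-- The flow polytope `{f ∈ ℝ^(E ∖ T) | -1 ≤ -C f ≤ 1, -1 ≤ f ≤ 1}`. -/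
def flowPolytope [Fintype E] [DecidableEq E] (T : Finset E) : Set ({e // e ∉ T} → ℝ) :=
  {f | (-G.forestMatrix T).mulVec f ∈ Set.Icc (-1) 1 ∧ f ∈ Set.Icc (-1) 1}

end DirMultigraph

/-- The Ehrhart function `L_A(k) = |ℤ^ι ∩ k A|`. -/
noncomputable def ehrhartFunction {ι : Type*} (A : Set (ι → ℝ)) (k : ℕ) : ℕ :=
  {z : ι → ℤ | (fun i => (z i : ℝ)) ∈ (k : ℝ) • A}.ncard

/-- `p` is the Ehrhart polynomial of `A`: it agrees with the Ehrhart function at every positive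
integer (hence is unique; its value at `0` is the value of the polynomial). -/
def IsEhrhartPolynomial {ι : Type*} (A : Set (ι → ℝ)) (p : Polynomial ℚ) : Prop :=
  ∀ k : ℕ, 0 < k → p.eval (k : ℚ) = (ehrhartFunction A k : ℚ)

/-- The entry `h*_i` of the `h*`-vector `(h*_0, …, h*_d)` of a polynomial `p` of degree `d`: the
coefficient of `z ^ i` in `(1 - z) ^ (d + 1) * ∑_{k ≥ 0} p(k) z ^ k`. -/
noncomputable def hStar (p : Polynomial ℚ) (i : ℕ) : ℚ :=
  PowerSeries.coeff i
    ((1 - PowerSeries.X) ^ (p.natDegree + 1) * PowerSeries.mk fun k : ℕ => p.eval (k : ℚ))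

/-- The `h*`-vector `(h*_0, …, h*_d)` of `p`, `d = deg p`, is palindromic. -/
def IsPalindromicHStar (p : Polynomial ℚ) : Prop :=
  ∀ i ≤ p.natDegree, hStar p i = hStar p (p.natDegree - i)

/-! Both polytopes have the form `{x | -1 ≤ A x ≤ 1, -1 ≤ x ≤ 1}` with `A` totally unimodular, and
only this shape matters for the counting. All facets are at lattice distance 1 from the origin, so
the interior lattice points of the `k`-th dilate are exactly the lattice points of the `(k-1)`-st.
Ehrhart–Macdonald reciprocity then reads `p(-1-x) = (-1)^n p(x)`, and this functional equation is
equivalent to a palindromic `h*`-vector when `n` is the degree.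

Reciprocity is proved from scratch, by induction on the dimension and for sums of polynomial weights
over half-open polytopes (`exists_levelSum_polynomial`). An injective homomorphism `lam` into an
ordered group acts as an infinitesimal generic perturbation: it decides which inequalities are
strict and forbids ties between facets. Unimodularity makes every coefficient of the first
coordinate 0 or ±1, so fibers have integral endpoints, and summation by parts with a polynomial
antidifference expresses the sum through facets (`levelSum_eq_sum_facets`), which are again
unimodular. Replacing `lam` by `-lam` exchanges strict and weak inequalities, and each summation by
parts contributes one sign.

For the graph, the incidence matrix `[M | N]`, split into forest and non-forest edges, is totally
unimodular, and `M * (-C) = N` with `M` left invertible by fundamental cuts. Hence minors of `-C`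
are, up to sign, minors of `[M | N]`. -/

/-- Telescoping over an integer interval. -/
theorem Int.sum_Ico_telescope (G : ℤ → ℚ) {a b : ℤ} (h : a ≤ b) :
    ∑ x ∈ Finset.Ico a b, (G (x + 1) - G x) = G b - G a := by
  induction b, h using Int.leInduction with
  | base => simp
  | succ b hb ih =>
    have : Finset.Ico a (b + 1) = insert b (Finset.Ico a b) := by
      ext x; simp only [Finset.mem_Ico, Finset.mem_insert]; omega
    rw [this, Finset.sum_insert (by simp), ih]; ring

/-! ### One-dimensional fibers: perturbed endpoints and boundary terms -/

section Fiber

variable {Γ : Type*} [LinearOrder Γ]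

/-- The first integer `x` for which `(x, t)` lies lexicographically above `y`. -/
noncomputable def lexCeil (t : Γ) (y : ℤ ×ₗ Γ) : ℤ :=
  (ofLex y).1 + if t < (ofLex y).2 then 1 else 0

/-- As `t` differs from the second component of `y`, equality never occurs, and one threshold
`lexCeil` serves upper bounds (strictly) and lower bounds (weakly). This makes every fiber a
half-open interval `Ico`. -/
theorem toLex_le_iff_lt_lexCeil {t : Γ} {y : ℤ ×ₗ Γ} (h : t ≠ (ofLex y).2) (x : ℤ) :
    toLex (x, t) ≤ y ↔ x < lexCeil t y := by
  rw [Prod.Lex.le_iff, lexCeil]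
  obtain ⟨⟨a, s⟩, rfl⟩ := toLex.surjective y
  simp only [ofLex_toLex] at h ⊢
  rcases lt_or_gt_of_ne h with h' | (h' : s < t)
  · simp only [h', h'.le, if_true, and_true]; omega
  · simp [not_lt.2 h'.le, not_le.2 h']

theorem le_toLex_iff_lexCeil_le {t : Γ} {y : ℤ ×ₗ Γ} (h : t ≠ (ofLex y).2) (x : ℤ) :
    y ≤ toLex (x, t) ↔ lexCeil t y ≤ x := by
  rw [Prod.Lex.le_iff, lexCeil]
  obtain ⟨⟨a, s⟩, rfl⟩ := toLex.surjective y
  simp only [ofLex_toLex] at h ⊢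
  rcases lt_or_gt_of_ne h with h' | (h' : s < t)
  · simp [h', not_le.2 h']
  · simp [not_lt.2 h'.le, h'.le, le_iff_lt_or_eq]

theorem lexCeil_mono (t : Γ) {y z : ℤ ×ₗ Γ} (h : y ≤ z) : lexCeil t y ≤ lexCeil t z := by
  rw [Prod.Lex.le_iff] at h
  unfold lexCeil
  rcases h with h | ⟨h, h'⟩
  · split_ifs <;> omega
  · split_ifs with h1 h2
    · omega
    · exact absurd (h1.trans_le h') h2
    all_goals omega

variable [AddCommGroup Γ] [IsOrderedAddMonoid Γ]

open Classical in
/-- Summing a difference over the integer points `x` of a half-open interval cut out by constraints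
`0 ≤ c ψ • (x, t) + w ψ` gives boundary terms, indexed by the constraints; each boundary term is
subject to the constraints evaluated at the corresponding endpoint. -/
theorem finsum_sub_eq_sum_boundary {ι : Type*} (S : Finset ι) (c : ι → ℤ) (w : ι → ℤ ×ₗ Γ) (t : Γ)
    (hc : ∀ φ ∈ S, c φ = -1 ∨ c φ = 0 ∨ c φ = 1)
    (hup : ∃ φ ∈ S, c φ = -1) (hlow : ∃ φ ∈ S, c φ = 1)
    (hinj : ∀ φ ∈ S, ∀ ψ ∈ S, c φ = c ψ → c φ ≠ 0 → w φ = w ψ → φ = ψ)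
    (ht : ∀ φ ∈ S, c φ ≠ 0 → t ≠ (ofLex (-(c φ • w φ))).2) (G : ℤ → ℚ) :
    (∑ᶠ x : ℤ, if ∀ ψ ∈ S, 0 ≤ c ψ • toLex (x, t) + w ψ then G (x + 1) - G x else 0) =
      ∑ φ ∈ S, -(c φ : ℚ) *
        if ∀ ψ ∈ S, 0 ≤ c ψ • (-(c φ • w φ)) + w ψ then G (lexCeil t (-(c φ • w φ))) else 0 := by
  -- `M` is the tightest upper bound and `m` the tightest lower bound. All other constraints that
  -- involve `x` are implied by these two.
  obtain ⟨M, hM, hMmin⟩ := (S.filter (fun φ => c φ = -1)).exists_min_image w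
    (by obtain ⟨φ, h, h'⟩ := hup; exact ⟨φ, by simp [h, h']⟩)
  obtain ⟨m, hm, hmmin⟩ := (S.filter (fun φ => c φ = 1)).exists_min_image w
    (by obtain ⟨φ, h, h'⟩ := hlow; exact ⟨φ, by simp [h, h']⟩)
  rw [Finset.mem_filter] at hM hm
  simp only [Finset.mem_filter, and_imp] at hMmin hmmin
  obtain ⟨hMS, hMc⟩ := hM
  obtain ⟨hmS, hmc⟩ := hm
  have key : ∀ y : ℤ ×ₗ Γ, (∀ ψ ∈ S, 0 ≤ c ψ • y + w ψ) ↔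
      ((∀ ψ ∈ S, c ψ = 0 → 0 ≤ w ψ) ∧ -w m ≤ y ∧ y ≤ w M) := by
    intro y
    constructor
    · intro h
      refine ⟨fun ψ hψ h0 => by simpa [h0] using h ψ hψ, ?_, ?_⟩
      · have := h m hmS
        rw [hmc, one_smul] at this
        rwa [neg_le_iff_add_nonneg]
      · have := h M hMS
        rw [hMc, neg_one_zsmul] at this
        rwa [← neg_le_iff_add_nonneg, neg_le_neg_iff] at this
    · rintro ⟨h0, h1, h2⟩ ψ hψ
      rcases hc ψ hψ with h | h | h
      · rw [h, neg_one_zsmul, ← neg_le_iff_add_nonneg, neg_le_neg_iff]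
        exact h2.trans (hMmin ψ hψ h)
      · rw [h, zero_smul, zero_add]; exact h0 ψ hψ h
      · rw [h, one_smul, ← neg_le_iff_add_nonneg]
        exact (neg_le_neg (hmmin ψ hψ h)).trans h1
  simp only [key]
  have htM : t ≠ (ofLex (w M)).2 := by
    have := ht M hMS (by omega)
    rwa [hMc, neg_one_zsmul, neg_neg] at this
  have htm : t ≠ (ofLex (-w m)).2 := by
    have := ht m hmS (by omega)
    rwa [hmc, one_smul] at this
  simp only [toLex_le_iff_lt_lexCeil htM, le_toLex_iff_lexCeil_le htm]
  have hMm : M ≠ m := by rintro rfl; omega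
  rw [Finset.sum_eq_add_of_mem M m hMS hmS hMm]
  · rw [hMc, hmc, neg_one_zsmul, neg_neg, one_smul]
    by_cases hZ : ∀ ψ ∈ S, c ψ = 0 → 0 ≤ w ψ
    swap
    · simp [hZ]
    have hs : ∀ x : ℤ, (if (∀ ψ ∈ S, c ψ = 0 → 0 ≤ w ψ) ∧ lexCeil t (-w m) ≤ x ∧
        x < lexCeil t (w M) then G (x + 1) - G x else 0) =
        if x ∈ Finset.Ico (lexCeil t (-w m)) (lexCeil t (w M)) then G (x + 1) - G x else 0 := by
      intro x
      simp only [Finset.mem_Ico]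
      congr 1
      exact propext ⟨fun h => h.2, fun h => ⟨hZ, h⟩⟩
    simp only [hs]
    rw [finsum_eq_sum_of_support_subset (s := Finset.Ico (lexCeil t (-w m)) (lexCeil t (w M)))]
    · rw [Finset.sum_ite_mem, Finset.inter_self]
      by_cases hle : -w m ≤ w M
      -- When the bounds cross, the interval is empty and both endpoints violate the constraints, so
      -- both sides vanish.
      · rw [Int.sum_Ico_telescope G (lexCeil_mono t hle), if_pos ⟨hZ, hle, le_rfl⟩,
          if_pos ⟨hZ, le_rfl, hle⟩]
        push_cast; ring
      · rw [Finset.Ico_eq_empty (by simpa using lexCeil_mono t (le_of_not_ge hle)),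
          if_neg (fun h => hle h.2.1), if_neg (fun h => hle h.2.2)]
        simp
    · intro x hx
      by_contra hx'
      exact hx (if_neg (by simpa using hx'))
  -- The root of any other constraint could be feasible only by tying with `M` or `m`, which `hinj`
  -- excludes.
  · rintro φ hφ ⟨hφM, hφm⟩
    rcases hc φ hφ with h | h | h
    · rw [if_neg, mul_zero]
      rintro ⟨-, -, h2⟩
      rw [h, neg_one_zsmul, neg_neg] at h2
      exact hφM (hinj φ hφ M hMS (by omega) (by omega) (le_antisymm h2 (hMmin φ hφ h)))
    · simp [h]
    · rw [if_neg, mul_zero]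
      rintro ⟨-, h2, -⟩
      rw [h, one_smul, neg_le_neg_iff] at h2
      exact hφm (hinj φ hφ m hmS (by omega) (by omega) (le_antisymm h2 (hmmin φ hφ h)))

end Fiber

/-! ### Polynomial weights: antidifferences and substitutions -/

section PolynomialWeights

/-- The value of a polynomial with rational coefficients at an integer vector. -/
noncomputable def intEval {m : ℕ} (P : MvPolynomial (Fin m) ℚ) (v : Fin m → ℤ) : ℚ :=
  MvPolynomial.eval (fun i => (v i : ℚ)) P

theorem intCast_cons {m : ℕ} (x : ℤ) (v : Fin m → ℤ) :
    (fun i => ((Fin.cons x v : Fin (m + 1) → ℤ) i : ℚ)) =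
      (Fin.cons (x : ℚ) (fun i => (v i : ℚ)) : Fin (m + 1) → ℚ) := by
  funext i
  refine Fin.cases ?_ (fun i => ?_) i <;> simp

theorem exists_antidifference {m : ℕ} (P : MvPolynomial (Fin (m + 1)) ℚ) :
    ∃ Q : MvPolynomial (Fin (m + 1)) ℚ, ∀ (x : ℤ) (v : Fin m → ℤ),
      intEval Q (Fin.cons (x + 1) v) - intEval Q (Fin.cons x v) = intEval P (Fin.cons x v) := by
  suffices h : ∀ p : Polynomial (MvPolynomial (Fin m) ℚ), ∃ q : Polynomial (MvPolynomial (Fin m) ℚ),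
      ∀ (x : ℚ) (v : Fin m → ℚ), (q.map (MvPolynomial.eval v)).eval (x + 1) -
        (q.map (MvPolynomial.eval v)).eval x = (p.map (MvPolynomial.eval v)).eval x by
    obtain ⟨q, hq⟩ := h (MvPolynomial.finSuccEquiv ℚ m P)
    refine ⟨(MvPolynomial.finSuccEquiv ℚ m).symm q, fun x v => ?_⟩
    simp only [intEval, intCast_cons, MvPolynomial.eval_eq_eval_mv_eval', AlgEquiv.apply_symm_apply]
    rw [← hq]
    push_cast
    rfl
  intro p
  induction p using Polynomial.induction_on' with
  | add p₁ p₂ h₁ h₂ =>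
    obtain ⟨q₁, h₁⟩ := h₁
    obtain ⟨q₂, h₂⟩ := h₂
    refine ⟨q₁ + q₂, fun x v => ?_⟩
    simp only [Polynomial.map_add, Polynomial.eval_add, ← h₁, ← h₂]
    ring
  | monomial d a =>
    -- The antidifference of `x ^ d` is `B_{d+1}(x) / (d + 1)`, with `B` the Bernoulli polynomial.
    refine ⟨Polynomial.C (a * MvPolynomial.C (1 / (d + 1 : ℚ))) *
      (Polynomial.bernoulli (d + 1)).map MvPolynomial.C, fun x v => ?_⟩
    have hd : (d + 1 : ℚ) ≠ 0 := by positivity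
    simp only [Polynomial.map_mul, Polynomial.map_C, Polynomial.map_map, Polynomial.eval_mul,
      Polynomial.eval_C, Polynomial.map_monomial, Polynomial.eval_monomial, map_mul,
      MvPolynomial.eval_C]
    have hid : (MvPolynomial.eval v).comp MvPolynomial.C = RingHom.id ℚ := by
      ext; simp
    rw [hid, Polynomial.map_id, add_comm x 1, Polynomial.bernoulli_eval_one_add]
    push_cast
    field_simp
    ring

theorem exists_substitution {m : ℕ} (Q : MvPolynomial (Fin (m + 1)) ℚ) (ψ : Fin m → ℤ) (s : ℤ) :
    ∃ R : MvPolynomial (Fin m) ℚ, ∀ v : Fin m → ℤ,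
      intEval R v = intEval Q (Fin.cons (ψ ⬝ᵥ v + s) v) := by
  refine ⟨MvPolynomial.bind₁ (Fin.cons (∑ i, MvPolynomial.C (ψ i : ℚ) * MvPolynomial.X i +
    MvPolynomial.C (s : ℚ)) MvPolynomial.X) Q, fun v => ?_⟩
  unfold intEval
  rw [← MvPolynomial.coe_aeval_eq_eval, RingHom.coe_coe, MvPolynomial.aeval_bind₁,
    ← MvPolynomial.coe_aeval_eq_eval, RingHom.coe_coe]
  congr 2
  rw [intCast_cons]
  funext i
  refine Fin.cases ?_ (fun i => ?_) i
  · simp [dotProduct]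
  · simp

end PolynomialWeights

/-! ### Half-open cones and elimination of a coordinate -/

section Regions

variable {Γ : Type*} [AddCommGroup Γ]

/-- The restriction of sign data to the forms not involving coordinate `0`. -/
def tailHom {m : ℕ} (lam : (Fin (m + 1) → ℤ) →+ Γ) : (Fin m → ℤ) →+ Γ where
  toFun φ := lam (Fin.cons 0 φ)
  map_zero' := by
    have : (Fin.cons 0 0 : Fin (m + 1) → ℤ) = 0 := by
      funext i; refine Fin.cases ?_ (fun i => ?_) i <;> simp
    rw [this, map_zero]
  map_add' φ ψ := by
    rw [← map_add]
    congr 1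
    funext i; refine Fin.cases ?_ (fun i => ?_) i <;> simp

theorem tailHom_injective {m : ℕ} {lam : (Fin (m + 1) → ℤ) →+ Γ} (h : Function.Injective lam) :
    Function.Injective (tailHom lam) := fun _ _ hab => Fin.cons_right_injective _ (h hab)

/-- The value of a linear form at `v`, paired with its sign data. -/
def lexVal {m : ℕ} (lam : (Fin m → ℤ) →+ Γ) (v : Fin m → ℤ) : (Fin m → ℤ) →+ ℤ ×ₗ Γ where
  toFun φ := toLex (φ ⬝ᵥ v, lam φ)
  map_zero' := by simp
  map_add' φ ψ := by simp [add_dotProduct]; rfl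

/-- Eliminate the coordinate `0` from `ψ` by means of `φ`, assuming `φ 0 = ±1`. -/
def elimForm {m : ℕ} (φ ψ : Fin (m + 1) → ℤ) : Fin m → ℤ :=
  Fin.tail ψ - (ψ 0 * φ 0) • Fin.tail φ

/-- The system of forms induced on the hyperplane `φ = 0`. -/
def facetForms {m : ℕ} (S : Finset (Fin (m + 1) → ℤ)) (φ : Fin (m + 1) → ℤ) :
    Finset (Fin m → ℤ) :=
  S.image (elimForm φ)

/-- The coordinate `0` of the point of the hyperplane `φ = 0` above `v`, assuming `φ 0 = ±1`. -/
def rootForm {m : ℕ} (φ : Fin (m + 1) → ℤ) : Fin m → ℤ := -(φ 0 • Fin.tail φ)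

theorem dotProduct_cons' {m : ℕ} (ψ : Fin (m + 1) → ℤ) (x : ℤ) (v : Fin m → ℤ) :
    ψ ⬝ᵥ (Fin.cons x v : Fin (m + 1) → ℤ) = ψ 0 * x + Fin.tail ψ ⬝ᵥ v := by
  simp [dotProduct, Fin.sum_univ_succ, Fin.tail]

theorem elimForm_dotProduct {m : ℕ} (φ ψ : Fin (m + 1) → ℤ) (v : Fin m → ℤ) :
    elimForm φ ψ ⬝ᵥ v = ψ ⬝ᵥ (Fin.cons (rootForm φ ⬝ᵥ v) v : Fin (m + 1) → ℤ) := by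
  rw [dotProduct_cons', elimForm, rootForm, sub_dotProduct, neg_dotProduct, smul_dotProduct,
    smul_dotProduct]
  simp only [smul_eq_mul]; ring

theorem lexVal_cons {m : ℕ} (lam : (Fin (m + 1) → ℤ) →+ Γ) (x : ℤ) (v : Fin m → ℤ)
    (ψ : Fin (m + 1) → ℤ) :
    lexVal lam (Fin.cons x v) ψ =
      ψ 0 • toLex (x, lam (Fin.cons 1 0)) + lexVal (tailHom lam) v (Fin.tail ψ) := by
  have h : ψ = ψ 0 • (Fin.cons 1 0 : Fin (m + 1) → ℤ) + Fin.cons 0 (Fin.tail ψ) := by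
    funext i; refine Fin.cases ?_ (fun i => ?_) i <;> simp [Fin.tail]
  have h2 : lam ψ = ψ 0 • lam (Fin.cons 1 0) + tailHom lam (Fin.tail ψ) := by
    conv_lhs => rw [h, map_add, map_zsmul]
    rfl
  refine congrArg toLex (Prod.ext ?_ h2)
  change _ = ψ 0 • x + _
  rw [dotProduct_cons', smul_eq_mul]
  rfl

theorem lexVal_elimForm {m : ℕ} (lam : (Fin m → ℤ) →+ Γ) (v : Fin m → ℤ)
    (φ ψ : Fin (m + 1) → ℤ) :
    lexVal lam v (elimForm φ ψ) =
      ψ 0 • (-(φ 0 • lexVal lam v (Fin.tail φ))) + lexVal lam v (Fin.tail ψ) := by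
  rw [elimForm, map_sub, map_zsmul, mul_smul, zsmul_neg]
  abel

variable [LinearOrder Γ]

/-- The half-open cone in which each form `φ ∈ S` is nonnegative, and positive if `lam φ < 0`. -/
def halfOpenCone {m : ℕ} (S : Finset (Fin m → ℤ)) (lam : (Fin m → ℤ) →+ Γ) : Set (Fin m → ℤ) :=
  {v | ∀ φ ∈ S, 0 ≤ lexVal lam v φ}

open Classical in
/-- The sum of the weight `g` over the points of a half-open cone with last coordinate `k`. -/
noncomputable def levelSum {n : ℕ} (S : Finset (Fin (n + 1) → ℤ)) (lam : (Fin (n + 1) → ℤ) →+ Γ)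
    (g : (Fin (n + 1) → ℤ) → ℚ) (k : ℤ) : ℚ :=
  ∑ᶠ v, if v ∈ halfOpenCone S lam ∧ v (Fin.last n) = k then g v else 0

theorem dotProduct_nonneg_of_mem_halfOpenCone {m : ℕ} {S : Finset (Fin m → ℤ)}
    {lam : (Fin m → ℤ) →+ Γ} {v : Fin m → ℤ} (h : v ∈ halfOpenCone S lam) :
    ∀ φ ∈ S, 0 ≤ φ ⬝ᵥ v := by
  intro φ hφ
  have := h φ hφ
  rw [Prod.Lex.le_iff] at this
  rcases this with h | h
  · exact h.le
  · exact h.1.le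

end Regions

/-! ### Unimodular systems and their facets -/

section UnimodularSystems

/-- A finite set of integral linear forms in `n` variables and a homogenizing last variable, such
that the linear parts are totally unimodular and the polyhedra `{φ ≥ 0 | φ ∈ S}` at the various
levels of the last variable are bounded. -/
structure UnimodularSystem {n : ℕ} (S : Finset (Fin (n + 1) → ℤ)) : Prop where
  unimodular : ∀ (k : ℕ) (f : Fin k → Fin (n + 1) → ℤ) (g : Fin k → Fin n), (∀ i, f i ∈ S) →
    (Matrix.of fun i j => f i (g j).castSucc).det ∈ Set.range (SignType.cast : SignType → ℤ)
  recession : ∀ v : Fin (n + 1) → ℤ, v (Fin.last n) = 0 → (∀ φ ∈ S, 0 ≤ φ ⬝ᵥ v) → v = 0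
  finite : ∀ k : ℤ, {v : Fin (n + 1) → ℤ | v (Fin.last n) = k ∧ ∀ φ ∈ S, 0 ≤ φ ⬝ᵥ v}.Finite

theorem cons_last {n : ℕ} (x : ℤ) (v : Fin (n + 1) → ℤ) :
    (Fin.cons x v : Fin (n + 2) → ℤ) (Fin.last (n + 1)) = v (Fin.last n) := by
  rw [← Fin.succ_last, Fin.cons_succ]

theorem UnimodularSystem.coeff_zero {n : ℕ} {S : Finset (Fin (n + 2) → ℤ)}
    (hS : UnimodularSystem S) {φ : Fin (n + 2) → ℤ} (hφ : φ ∈ S) :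
    φ 0 = -1 ∨ φ 0 = 0 ∨ φ 0 = 1 := by
  obtain ⟨s, hs⟩ := hS.unimodular 1 (fun _ => φ) (fun _ => 0) (fun _ => hφ)
  rw [Matrix.det_fin_one] at hs
  simp only [Matrix.of_apply, Fin.castSucc_zero] at hs
  rw [← hs]
  cases s <;> simp

/-- Passing to the hyperplane `φ = 0` is a pivot on the entry `φ 0 = ±1`, which preserves
unimodularity. Boundedness is inherited because points of the facet lift to points of the original
polyhedron. -/
theorem UnimodularSystem.facetForms {n : ℕ} {S : Finset (Fin (n + 2) → ℤ)}
    (hS : UnimodularSystem S) {φ : Fin (n + 2) → ℤ} (hφ : φ ∈ S) (h0 : φ 0 ≠ 0) :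
    UnimodularSystem (facetForms S φ) := by
  have hsq : φ 0 * φ 0 = 1 := by
    rcases hS.coeff_zero hφ with h | h | h
    · simp [h]
    · exact absurd h h0
    · simp [h]
  have hlift : ∀ v : Fin (n + 1) → ℤ, (∀ ψ ∈ _root_.facetForms S φ, 0 ≤ ψ ⬝ᵥ v) →
      ∀ ψ ∈ S, 0 ≤ ψ ⬝ᵥ (Fin.cons (rootForm φ ⬝ᵥ v) v : Fin (n + 2) → ℤ) := by
    intro v hv ψ hψ
    rw [← elimForm_dotProduct]
    exact hv _ (Finset.mem_image_of_mem _ hψ)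
  refine ⟨fun k f g hf => ?_, fun v hv0 hv => ?_, fun k => ?_⟩
  · simp only [_root_.facetForms, Finset.mem_image] at hf
    choose f' hf'S hf' using hf
    -- The minor is bordered by the row `φ` and the column 0. Clearing that column with the row `φ`
    -- turns the bordered determinant into `φ 0` times the wanted one.
    have hmem := hS.unimodular (k + 1) (Fin.cons φ f') (Fin.cons 0 (fun j => (g j).succ)) (by
      intro i; refine Fin.cases ?_ (fun i => ?_) i <;> simp [hφ, hf'S])
    set B : Matrix (Fin (k + 1)) (Fin (k + 1)) ℤ := Matrix.of
      (Fin.cons (fun j => φ ((Fin.cons 0 (fun j => (g j).succ) : Fin (k + 1) → Fin (n + 1)) j).castSucc)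
        (fun i j => f' i ((Fin.cons 0 (fun j => (g j).succ) : Fin (k + 1) → Fin (n + 1)) j).castSucc
          - f' i 0 * φ 0 * φ ((Fin.cons 0 (fun j => (g j).succ) :
            Fin (k + 1) → Fin (n + 1)) j).castSucc)) with hB
    rw [Matrix.det_eq_of_forall_row_eq_smul_add_const (B := B)
      (Fin.cons 0 (fun i => f' i 0 * φ 0)) 0 (by simp)] at hmem
    · rw [Matrix.det_succ_column_zero, Fin.sum_univ_succ, Finset.sum_eq_zero] at hmem
      · have hsub : B.submatrix (Fin.succAbove 0) Fin.succ =
            Matrix.of fun i j => f i (g j).castSucc := by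
          ext i j
          simp [hB, ← hf', elimForm, Fin.tail]
        rw [hsub] at hmem
        have hB0 : B 0 0 = φ 0 := by simp [hB]
        rw [hB0] at hmem
        simp only [Fin.val_zero, pow_zero, one_mul, add_zero] at hmem
        obtain ⟨s, hs⟩ := hmem
        rcases hS.coeff_zero hφ with h | h | h
        · refine ⟨-s, ?_⟩
          rw [h] at hs
          rw [SignType.coe_neg, hs]; ring
        · exact absurd h h0
        · refine ⟨s, ?_⟩
          rw [hs, h, one_mul]
      · intro i _
        have : B i.succ 0 = 0 := by
          simp only [hB, Matrix.of_apply, Fin.cons_succ, Fin.cons_zero, Fin.castSucc_zero]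
          rw [mul_assoc, hsq]; ring
        rw [this]; ring
    · intro i j
      refine Fin.cases ?_ (fun i => ?_) i
      · simp [hB]
      · simp [hB]
  · have := hS.recession _ ((cons_last _ _).trans hv0) (hlift v hv)
    funext i
    simpa using congrFun this i.succ
  · refine Set.Finite.of_finite_image (f := fun v => (Fin.cons (rootForm φ ⬝ᵥ v) v : Fin (n + 2) → ℤ))
      ((hS.finite k).subset ?_) ?_
    · rintro _ ⟨v, ⟨hv1, hv2⟩, rfl⟩
      exact ⟨(cons_last _ _).trans hv1, hlift v hv2⟩
    · intro v _ v' _ h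
      exact (Fin.cons_inj.1 h).2

theorem UnimodularSystem.exists_coeff_zero_eq {n : ℕ} {S : Finset (Fin (n + 2) → ℤ)}
    (hS : UnimodularSystem S) (ε : ℤ) (hε : ε = 1 ∨ ε = -1) : ∃ φ ∈ S, φ 0 = ε := by
  by_contra! hcon
  -- If no form had coefficient `ε`, the direction `-ε` along coordinate 0 would be a nonzero
  -- recession direction.
  have := hS.recession (Fin.cons (-ε) 0) ((cons_last _ _).trans rfl) (by
    intro φ hφ
    rw [dotProduct_cons', dotProduct_zero, add_zero]
    have h1 := hcon φ hφ
    rcases hε with rfl | rfl <;> rcases hS.coeff_zero hφ with h | h | h <;> simp_all)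
  have := congrFun this 0
  rcases hε with rfl | rfl <;> simp at this

end UnimodularSystems

/-! ### Summation by parts over facets, polynomiality and reciprocity -/

section Reciprocity

variable {Γ : Type*} [AddCommGroup Γ]

theorem apply_cons_one_zero_ne {m : ℕ} {lam : (Fin (m + 1) → ℤ) →+ Γ}
    (hlam : Function.Injective lam) (ψ : Fin m → ℤ) : lam (Fin.cons 1 0) ≠ tailHom lam ψ := by
  intro h
  have := congrFun (hlam h) 0
  simp at this

variable [LinearOrder Γ]

/-- The offset of the endpoint determined by `φ`: it depends on whether the constraint `φ` is
weak or strict. -/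
noncomputable def rootShift {m : ℕ} (lam : (Fin (m + 1) → ℤ) →+ Γ) (φ : Fin (m + 1) → ℤ) : ℤ :=
  if lam (Fin.cons 1 0) < tailHom lam (rootForm φ) then 1 else 0

theorem finite_support_levelSum {n : ℕ} {S : Finset (Fin (n + 1) → ℤ)} (hS : UnimodularSystem S)
    (lam : (Fin (n + 1) → ℤ) →+ Γ) (k : ℤ) :
    {v | v ∈ halfOpenCone S lam ∧ v (Fin.last n) = k}.Finite :=
  (hS.finite k).subset fun _ hv => ⟨hv.2, dotProduct_nonneg_of_mem_halfOpenCone hv.1⟩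

theorem levelSum_neg_weight {n : ℕ} (S : Finset (Fin (n + 1) → ℤ))
    (lam : (Fin (n + 1) → ℤ) →+ Γ) (g : (Fin (n + 1) → ℤ) → ℚ) (k : ℤ) :
    levelSum S lam (fun v => -g v) k = -levelSum S lam g k := by
  unfold levelSum
  rw [← finsum_neg_distrib]
  congr 1
  funext v
  split_ifs <;> simp

/-- In dimension 0 there is one point, and a form vanishing there is zero, hence has zero sign data.
So `lam` has no influence, which lets the induction start with the same value for `lam` and `-lam`.
-/
theorem levelSum_fin_one (S : Finset (Fin 1 → ℤ)) (lam : (Fin 1 → ℤ) →+ Γ)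
    (g : (Fin 1 → ℤ) → ℚ) {k : ℤ} (hk : 0 < k) :
    levelSum S lam g k = if ∀ φ ∈ S, 0 ≤ φ 0 then g (fun _ => k) else 0 := by
  classical
  unfold levelSum
  rw [finsum_eq_single _ (fun _ => k)]
  · refine if_congr ?_ rfl rfl
    simp only [and_true]
    refine forall₂_congr fun φ _ => ?_
    have hdot : φ ⬝ᵥ (fun _ => k) = φ 0 * k := by simp [dotProduct]
    have hval : lexVal lam (fun _ => k) φ = toLex (φ 0 * k, lam φ) := by
      rw [← hdot]; rfl
    rw [hval, Prod.Lex.le_iff]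
    simp only [ofLex_toLex, ofLex_zero, Prod.fst_zero, Prod.snd_zero]
    constructor
    · rintro (h | h)
      · exact (pos_of_mul_pos_left h hk.le).le
      · exact nonneg_of_mul_nonneg_left h.1.le hk
    · intro h
      rcases h.lt_or_eq with h | h
      · exact Or.inl (mul_pos h hk)
      · refine Or.inr ⟨by simp [← h], ?_⟩
        have : φ = 0 := by
          funext i; rw [Fin.fin_one_eq_zero i, ← h]; rfl
        rw [this, map_zero]
  · intro v hv
    rw [if_neg]
    rintro ⟨-, h⟩
    exact hv (funext fun i => by rw [Fin.fin_one_eq_zero i]; exact h)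

variable [IsOrderedAddMonoid Γ]

-- Genericity comes from injectivity of `lam`: forms with equal coefficient 0 and equal perturbed
-- tails coincide, and a form involving coordinate 0 never ties with one that does not.
open Classical in
theorem finsum_fiber {n : ℕ} {S : Finset (Fin (n + 2) → ℤ)} (hS : UnimodularSystem S)
    {lam : (Fin (n + 2) → ℤ) →+ Γ} (hlam : Function.Injective lam)
    {g G : (Fin (n + 2) → ℤ) → ℚ}
    (hG : ∀ x v, G (Fin.cons (x + 1) v) - G (Fin.cons x v) = g (Fin.cons x v))
    (v : Fin (n + 1) → ℤ) :
    (∑ᶠ x : ℤ, if Fin.cons x v ∈ halfOpenCone S lam then g (Fin.cons x v) else 0) =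
      ∑ φ ∈ S, -(φ 0 : ℚ) * if v ∈ halfOpenCone (facetForms S φ) (tailHom lam) then
        G (Fin.cons (rootForm φ ⬝ᵥ v + rootShift lam φ) v) else 0 := by
  have hroot : ∀ φ : Fin (n + 2) → ℤ, -(φ 0 • lexVal (tailHom lam) v (Fin.tail φ)) =
      lexVal (tailHom lam) v (rootForm φ) := by
    intro φ
    rw [rootForm, map_neg, map_zsmul]
  have := finsum_sub_eq_sum_boundary S (fun φ => φ 0)
    (fun φ => lexVal (tailHom lam) v (Fin.tail φ)) (lam (Fin.cons 1 0))
    (fun φ hφ => hS.coeff_zero hφ) (hS.exists_coeff_zero_eq (-1) (Or.inr rfl))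
    (hS.exists_coeff_zero_eq 1 (Or.inl rfl))
    (by
      intro φ _ ψ _ h0 _ hw
      have h2 : tailHom lam (Fin.tail φ) = tailHom lam (Fin.tail ψ) :=
        congrArg (fun y => (ofLex y).2) hw
      rw [← Fin.cons_self_tail φ, ← Fin.cons_self_tail ψ, tailHom_injective hlam h2]
      exact congrArg (fun x => (Fin.cons x (Fin.tail ψ) : Fin (n + 2) → ℤ)) h0)
    (by
      intro φ _ _
      rw [hroot]
      exact apply_cons_one_zero_ne hlam _)
    (fun x => G (Fin.cons x v))
  simp only [hG, ← lexVal_cons, ← lexVal_elimForm] at this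
  have hmem : ∀ x : ℤ, Fin.cons x v ∈ halfOpenCone S lam ↔
      ∀ ψ ∈ S, 0 ≤ lexVal lam (Fin.cons x v) ψ := fun x => Iff.rfl
  simp only [hmem]
  rw [this]
  refine Finset.sum_congr rfl fun φ _ => ?_
  rw [hroot]
  congr 1
  refine if_congr ?_ rfl rfl
  simp [halfOpenCone, facetForms]

/-- Summation by parts along the coordinate `0`. -/
theorem levelSum_eq_sum_facets {n : ℕ} {S : Finset (Fin (n + 2) → ℤ)} (hS : UnimodularSystem S)
    {lam : (Fin (n + 2) → ℤ) →+ Γ} (hlam : Function.Injective lam)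
    {g G : (Fin (n + 2) → ℤ) → ℚ}
    (hG : ∀ x v, G (Fin.cons (x + 1) v) - G (Fin.cons x v) = g (Fin.cons x v)) (k : ℤ) :
    levelSum S lam g k = ∑ φ ∈ S, -(φ 0 : ℚ) * levelSum (facetForms S φ) (tailHom lam)
      (fun v => G (Fin.cons (rootForm φ ⬝ᵥ v + rootShift lam φ) v)) k := by
  classical
  have hfin : Function.HasFiniteSupport (fun v : Fin (n + 2) → ℤ =>
      if v ∈ halfOpenCone S lam ∧ v (Fin.last (n + 1)) = k then g v else 0) := by
    refine (finite_support_levelSum hS lam k).subset fun v hv => ?_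
    by_contra hv'
    exact hv (if_neg hv')
  set e : (Fin (n + 1) → ℤ) × ℤ ≃ (Fin (n + 2) → ℤ) :=
    (Equiv.prodComm _ _).trans (Fin.consEquiv (fun _ => ℤ)) with he
  unfold levelSum
  rw [← finsum_comp_equiv e, finsum_curry]
  swap
  · exact hfin.preimage e.injective.injOn
  have hinner : ∀ v : Fin (n + 1) → ℤ, (∑ᶠ x : ℤ, if e (v, x) ∈ halfOpenCone S lam ∧
      e (v, x) (Fin.last (n + 1)) = k then g (e (v, x)) else 0) =
      ∑ φ ∈ S, -(φ 0 : ℚ) * if v ∈ halfOpenCone (facetForms S φ) (tailHom lam) ∧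
        v (Fin.last n) = k then G (Fin.cons (rootForm φ ⬝ᵥ v + rootShift lam φ) v) else 0 := by
    intro v
    have hex : ∀ x, e (v, x) = Fin.cons x v := fun x => rfl
    simp only [hex, cons_last]
    by_cases hv : v (Fin.last n) = k
    · simp only [hv, and_true]
      exact finsum_fiber hS hlam hG v
    · simp [hv]
  simp only [hinner]
  rw [finsum_sum_comm]
  · refine Finset.sum_congr rfl fun φ _ => ?_
    rw [mul_finsum]
  · intro φ hφ
    by_cases h0 : φ 0 = 0
    · simp [h0, Function.HasFiniteSupport]
    · refine (finite_support_levelSum (hS.facetForms hφ h0) (tailHom lam) k).subset fun v hv => ?_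
      by_contra hv'
      exact hv ((congrArg _ (if_neg hv')).trans (mul_zero _))

/-- Reversing the perturbation makes a weak endpoint strict and conversely, which moves it by
exactly one lattice step. -/
theorem rootShift_neg {m : ℕ} {lam : (Fin (m + 1) → ℤ) →+ Γ} (hlam : Function.Injective lam)
    (φ : Fin (m + 1) → ℤ) : rootShift (-lam) φ = 1 - rootShift lam φ := by
  unfold rootShift
  have h : tailHom (-lam) (rootForm φ) = -tailHom lam (rootForm φ) := rfl
  simp only [h, AddMonoidHom.neg_apply, neg_lt_neg_iff]
  rcases lt_or_gt_of_ne (apply_cons_one_zero_ne hlam (rootForm φ)) with h' | h'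
  · simp [h', not_lt.2 h'.le]
  · simp [h', not_lt.2 (le_of_lt h')]

theorem neg_cons {m : ℕ} (x : ℤ) (v : Fin m → ℤ) :
    -(Fin.cons x v : Fin (m + 1) → ℤ) = Fin.cons (-x) (-v) := by
  funext i
  refine Fin.cases ?_ (fun i => ?_) i <;> simp

/-- Polynomiality and reciprocity for sums of polynomials over half-open unimodular polytopes. -/
theorem exists_levelSum_polynomial {n : ℕ} : ∀ {S : Finset (Fin (n + 1) → ℤ)},
    UnimodularSystem S → ∀ {lam : (Fin (n + 1) → ℤ) →+ Γ}, Function.Injective lam →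
    ∀ P : MvPolynomial (Fin (n + 1)) ℚ, ∃ p : Polynomial ℚ, ∀ k : ℤ, 0 < k →
      p.eval (k : ℚ) = levelSum S lam (intEval P) k ∧
      p.eval (-(k : ℚ)) = (-1) ^ n * levelSum S (-lam) (fun v => intEval P (-v)) k := by
  induction n with
  | zero =>
    intro S _ lam _ P
    classical
    refine ⟨if ∀ φ ∈ S, 0 ≤ φ 0 then MvPolynomial.aeval (fun _ => Polynomial.X) P else 0,
      fun k hk => ?_⟩
    have hev : ∀ x : ℚ, (MvPolynomial.aeval (fun _ : Fin 1 => (Polynomial.X : Polynomial ℚ)) P).eval x =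
        MvPolynomial.eval (fun _ => x) P := by
      intro x
      rw [← Polynomial.coe_evalRingHom, ← RingHom.coe_coe (MvPolynomial.aeval _), ← RingHom.comp_apply]
      congr 1
      ext i <;> simp
    rw [levelSum_fin_one S lam _ hk, levelSum_fin_one S (-lam) _ hk]
    split_ifs with h
    · rw [hev, hev]
      simp [intEval, Pi.neg_apply]
    · simp
  | succ n ih =>
    intro S hS lam hlam P
    obtain ⟨Q, hQ⟩ := exists_antidifference P
    have hface : ∀ φ : Fin (n + 2) → ℤ, ∃ p : Polynomial ℚ, φ ∈ S → φ 0 ≠ 0 → ∀ k : ℤ, 0 < k →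
        p.eval (k : ℚ) = levelSum (facetForms S φ) (tailHom lam)
          (fun v => intEval Q (Fin.cons (rootForm φ ⬝ᵥ v + rootShift lam φ) v)) k ∧
        p.eval (-(k : ℚ)) = (-1) ^ n * levelSum (facetForms S φ) (-tailHom lam)
          (fun v => intEval Q (Fin.cons (rootForm φ ⬝ᵥ (-v) + rootShift lam φ) (-v))) k := by
      intro φ
      by_cases h : φ ∈ S ∧ φ 0 ≠ 0
      · obtain ⟨R, hR⟩ := exists_substitution Q (rootForm φ) (rootShift lam φ)
        obtain ⟨p, hp⟩ := ih (hS.facetForms h.1 h.2) (tailHom_injective hlam) R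
        refine ⟨p, fun _ _ k hk => ?_⟩
        simp only [← hR]
        exact hp k hk
      · exact ⟨0, fun h1 h2 => absurd ⟨h1, h2⟩ h⟩
    choose p hp using hface
    refine ⟨∑ φ ∈ S, Polynomial.C (-(φ 0 : ℚ)) * p φ, fun k hk => ⟨?_, ?_⟩⟩
    · rw [levelSum_eq_sum_facets hS hlam hQ, Polynomial.eval_finsetSum]
      refine Finset.sum_congr rfl fun φ hφ => ?_
      rw [Polynomial.eval_mul, Polynomial.eval_C]
      by_cases h0 : φ 0 = 0
      · simp [h0]
      · rw [(hp φ hφ h0 k hk).1]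
    · have hneg : Function.Injective (-lam) := fun a b hab => hlam (neg_injective hab)
      -- `x ↦ -Q(1 - x, -v)` is an antidifference of `x ↦ P(-x, -v)`. Its 1 cancels against the one
      -- in `rootShift_neg`, so the endpoint value is the facet weight at `-v`. The minus sign in
      -- front supplies the extra factor of `(-1) ^ (n + 1)`.
      rw [levelSum_eq_sum_facets (G := fun v => -intEval Q (Fin.cons (1 - v 0) (-Fin.tail v)))
        hS hneg, Polynomial.eval_finsetSum, Finset.mul_sum]
      · refine Finset.sum_congr rfl fun φ hφ => ?_
        rw [Polynomial.eval_mul, Polynomial.eval_C]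
        by_cases h0 : φ 0 = 0
        · simp [h0]
        · rw [(hp φ hφ h0 k hk).2, levelSum_neg_weight]
          have htail : tailHom (-lam) = -tailHom lam := rfl
          have hw : (fun v : Fin (n + 1) → ℤ => intEval Q (Fin.cons
              (1 - (Fin.cons (rootForm φ ⬝ᵥ v + rootShift (-lam) φ) v : Fin (n + 2) → ℤ) 0)
              (-Fin.tail (Fin.cons (rootForm φ ⬝ᵥ v + rootShift (-lam) φ) v : Fin (n + 2) → ℤ)))) =
              fun v => intEval Q (Fin.cons (rootForm φ ⬝ᵥ (-v) + rootShift lam φ) (-v)) := by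
            funext v
            rw [Fin.cons_zero, Fin.tail_cons, rootShift_neg hlam, dotProduct_neg]
            congr 2
            ring
          rw [hw, htail]
          ring
      · intro x v
        rw [neg_cons, ← hQ]
        simp only [Fin.cons_zero, Fin.tail_cons]
        rw [show 1 - (x + 1) = -x by ring, show 1 - x = -x + 1 by ring]
        ring

end Reciprocity

/-! ### From the functional equation to a palindromic `h*`-vector -/

section HStar

theorem coeff_one_sub_X_pow (N j : ℕ) :
    PowerSeries.coeff j ((1 - PowerSeries.X : PowerSeries ℚ) ^ N) = (-1) ^ j * (N.choose j : ℚ) := by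
  have h : ((1 - PowerSeries.X : PowerSeries ℚ) ^ N) =
      (((1 + Polynomial.X : Polynomial ℚ) ^ N).comp (-Polynomial.X) : Polynomial ℚ) := by
    simp [sub_eq_add_neg]
  rw [h, Polynomial.coeff_coe, ← neg_one_mul (Polynomial.X : Polynomial ℚ), ← Polynomial.C_1, ← Polynomial.C_neg,
    Polynomial.comp_C_mul_X_coeff, Polynomial.C_1, Polynomial.coeff_one_add_X_pow, mul_comm]

theorem hStar_eq_sum (p : Polynomial ℚ) (i : ℕ) :
    hStar p i = ∑ j ∈ Finset.range (i + 1),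
      (-1) ^ j * ((p.natDegree + 1).choose j : ℚ) * p.eval ((i : ℚ) - j) := by
  rw [hStar, PowerSeries.coeff_mul, Finset.Nat.sum_antidiagonal_eq_sum_range_succ_mk]
  refine Finset.sum_congr rfl fun j hj => ?_
  rw [coeff_one_sub_X_pow, PowerSeries.coeff_mk, Nat.cast_sub (by simpa [Nat.lt_succ_iff] using hj)]

/-- This is the `(d+1)`-st finite difference of a polynomial of degree `d`. -/
theorem sum_alternating_choose_eval (p : Polynomial ℚ) (x : ℚ) :
    ∑ j ∈ Finset.range (p.natDegree + 2),
      (-1) ^ j * ((p.natDegree + 1).choose j : ℚ) * p.eval (x - j) = 0 := by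
  set q := p.comp (Polynomial.C x - Polynomial.X) with hq
  have hdeg : q.natDegree < p.natDegree + 1 := by
    rw [hq, Polynomial.natDegree_comp]
    have : (Polynomial.C x - Polynomial.X : Polynomial ℚ).natDegree ≤ 1 := by compute_degree
    nlinarith
  have h := congrFun (Polynomial.fwdDiff_iter_eq_zero_of_degree_lt hdeg) 0
  rw [fwdDiff_iter_eq_sum_shift] at h
  have h' : ∑ j ∈ Finset.range (p.natDegree + 1 + 1), (-1 : ℚ) ^ (p.natDegree + 1) *
      ((-1) ^ j * ((p.natDegree + 1).choose j : ℚ) * p.eval (x - j)) = 0 := by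
    refine Eq.trans (Finset.sum_congr rfl fun j hj => ?_) h
    have hj' : j ≤ p.natDegree + 1 := by simpa [Nat.lt_succ_iff] using hj
    obtain ⟨r, hr⟩ := Nat.exists_eq_add_of_le hj'
    have hsign : (-1 : ℚ) ^ (p.natDegree + 1) * (-1) ^ j = (-1) ^ (p.natDegree + 1 - j) := by
      rw [hr, Nat.add_sub_cancel_left, pow_add]
      have : (-1 : ℚ) ^ j * (-1) ^ j = 1 := by rw [← mul_pow]; simp
      linear_combination (-1) ^ r * this
    rw [← mul_assoc, ← mul_assoc, hsign]
    simp [hq]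
  rw [← Finset.mul_sum] at h'
  exact (mul_eq_zero.1 h').resolve_left (pow_ne_zero _ (by norm_num))

/-- The vanishing difference, started at `i`, splits into `h*_i` and the terms with `j > i`. Those
evaluate `p` at negative integers; the functional equation and the symmetry of binomials turn them
into `-h*_{d-i}`. -/
theorem isPalindromicHStar_of_eval_neg {p : Polynomial ℚ}
    (h : ∀ x : ℚ, p.eval (-1 - x) = (-1) ^ p.natDegree * p.eval x) : IsPalindromicHStar p := by
  intro i hi
  obtain ⟨r, hr⟩ := Nat.exists_eq_add_of_le hi
  have hz := sum_alternating_choose_eval p i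
  rw [show p.natDegree + 2 = (i + 1) + (r + 1) by omega, Finset.sum_range_add,
    ← hStar_eq_sum] at hz
  rw [eq_neg_of_add_eq_zero_left hz, show p.natDegree - i = r by omega, hStar_eq_sum,
    ← Finset.sum_range_reflect, ← Finset.sum_neg_distrib]
  refine Finset.sum_congr rfl fun j hj => ?_
  have hj' : j ≤ r := by simpa [Nat.lt_succ_iff] using hj
  obtain ⟨s, rfl⟩ := Nat.exists_eq_add_of_le hj'
  have h1 : j + s + 1 - 1 - j = s := by omega
  rw [h1]
  have hch : (p.natDegree + 1).choose (i + 1 + s) = (p.natDegree + 1).choose j :=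
    Nat.choose_symm_of_eq_add (by omega)
  rw [hch]
  have hev : p.eval ((i : ℚ) - ((i + 1 + s : ℕ) : ℚ)) =
      (-1) ^ p.natDegree * p.eval (((j + s : ℕ) : ℚ) - j) := by
    rw [← h]
    congr 1
    push_cast; ring
  rw [hev, hr]
  have hsign : (-1 : ℚ) ^ (i + 1 + s) * (-1) ^ (i + (j + s)) = -(-1) ^ j := by
    rw [← pow_add, show i + 1 + s + (i + (j + s)) = 2 * (i + s) + (j + 1) by ring, pow_add,
      pow_mul]
    simp only [even_two, Even.neg_pow, one_pow, one_mul]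
    ring
  linear_combination -((((i + (j + s)) + 1).choose j : ℚ) *
    p.eval (((j + s : ℕ) : ℚ) - j)) * hsign

end HStar

/-! ### Degree from growth -/

section Degree

open Filter Topology in
theorem natDegree_eq_of_growth {p : Polynomial ℚ} {n a : ℕ} (ha : 0 < a)
    (hup : ∀ k : ℕ, 0 < k → |p.eval (k : ℚ)| ≤ (2 * k + 1) ^ n)
    (hlow : ∀ k : ℕ, 0 < k → (k : ℚ) ^ n ≤ |p.eval ((a * k : ℕ) : ℚ)|) : p.natDegree = n := by
  have hp0 : p ≠ 0 := by
    rintro rfl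
    have := hlow 1 one_pos
    norm_num at this
  refine le_antisymm ?_ ?_
  · by_contra! hlt
    have ht := Polynomial.abs_div_tendsto_atTop_atTop_of_degree_gt p
      ((2 * Polynomial.X + 1) ^ n : Polynomial ℚ) (by
        have hd : ((2 * Polynomial.X + 1) ^ n : Polynomial ℚ).natDegree ≤ n := by
          refine Polynomial.natDegree_pow_le.trans ?_
          have : (2 * Polynomial.X + 1 : Polynomial ℚ).natDegree ≤ 1 := by compute_degree
          nlinarith
        exact Polynomial.degree_lt_degree (hd.trans_lt hlt)) (by
        refine pow_ne_zero _ fun h => ?_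
        have := congrArg (Polynomial.eval 0) h
        simp at this)
    have ht' := ht.comp (tendsto_natCast_atTop_atTop (R := ℚ))
    obtain ⟨k, hk1, hk2⟩ := ((ht'.eventually_gt_atTop 1).and (eventually_gt_atTop 0)).exists
    have hpos : (0 : ℚ) < (2 * k + 1) ^ n := by positivity
    simp only [Function.comp, Polynomial.eval_pow, Polynomial.eval_add, Polynomial.eval_mul,
      Polynomial.eval_X, Polynomial.eval_one, Polynomial.eval_ofNat, abs_div, abs_of_pos hpos] at hk1
    exact absurd (hup k hk2) (not_le.2 ((one_lt_div hpos).1 hk1))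
  · by_contra! hlt
    have ht := Polynomial.div_tendsto_atTop_zero_of_degree_lt p (Polynomial.X ^ n : Polynomial ℚ) (by
      rw [Polynomial.degree_X_pow, Polynomial.degree_eq_natDegree hp0]
      exact_mod_cast hlt)
    have hmul : Tendsto (fun k : ℕ => ((a * k : ℕ) : ℚ)) atTop atTop := by
      refine (tendsto_natCast_atTop_atTop (R := ℚ)).comp ?_
      exact tendsto_id.const_mul_atTop' ha
    have ht' := (ht.comp hmul).abs
    rw [abs_zero] at ht'
    have hε : (0 : ℚ) < 1 / (a : ℚ) ^ n := by positivity
    obtain ⟨k, hk1, hk2⟩ := ((ht'.eventually_lt_const hε).and (eventually_gt_atTop 0)).exists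
    have hkpos : (0 : ℚ) < k := by exact_mod_cast hk2
    have hapos : (0 : ℚ) < a := by exact_mod_cast ha
    simp only [Function.comp, Polynomial.eval_pow, Polynomial.eval_X, abs_div] at hk1
    have hpos : (0 : ℚ) < ((a * k : ℕ) : ℚ) ^ n := by
      push_cast; positivity
    rw [abs_of_pos hpos, div_lt_div_iff₀ hpos (by positivity), one_mul] at hk1
    have h2 := mul_le_mul_of_nonneg_right (hlow k hk2) (show (0 : ℚ) ≤ (a : ℚ) ^ n by positivity)
    rw [← mul_pow] at h2
    rw [Nat.cast_mul, mul_comm (a : ℚ)] at hk1 h2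
    linarith

end Degree

/-! ### The symmetric polytopes of a totally unimodular matrix -/

section SymmetricPolytopes

/-- The integer points of the `k`-th dilate of `{x | -1 ≤ A x ≤ 1, -1 ≤ x ≤ 1}`. -/
def symmPoints {m ι : Type*} [Fintype ι] (A : Matrix m ι ℤ) (k : ℤ) : Set (ι → ℤ) :=
  {z | (∀ i, |A.mulVec z i| ≤ k) ∧ ∀ j, |z j| ≤ k}

/-- The homogenized linear forms cutting out `{x | -1 ≤ A x ≤ 1, -1 ≤ x ≤ 1}`. -/
def symmForms {m : Type*} [Fintype m] {n : ℕ} (A : Matrix m (Fin n) ℤ) :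
    Finset (Fin (n + 1) → ℤ) :=
  Finset.univ.image fun x : (m ⊕ Fin n) × ℤˣ =>
    (Fin.snoc (fun j => (x.2 : ℤ) * Matrix.fromRows A 1 x.1 j) 1 : Fin (n + 1) → ℤ)

variable {m : Type*} [Fintype m] {n : ℕ}

theorem forall_units_int_iff {P : ℤˣ → Prop} : (∀ u, P u) ↔ P 1 ∧ P (-1) :=
  ⟨fun h => ⟨h 1, h (-1)⟩, fun h u => by rcases Int.units_eq_one_or u with rfl | rfl; exacts [h.1, h.2]⟩

theorem snoc_dotProduct (w : Fin n → ℤ) (c : ℤ) (v : Fin (n + 1) → ℤ) :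
    (Fin.snoc w c : Fin (n + 1) → ℤ) ⬝ᵥ v = w ⬝ᵥ (fun j => v j.castSucc) + c * v (Fin.last n) := by
  simp [dotProduct, Fin.sum_univ_castSucc]

theorem forall_mem_symmForms {A : Matrix m (Fin n) ℤ} {P : ℤ → Prop} (v : Fin (n + 1) → ℤ) :
    (∀ φ ∈ symmForms A, P (φ ⬝ᵥ v)) ↔ ∀ x : (m ⊕ Fin n), ∀ u : ℤˣ,
      P (u * (Matrix.fromRows A 1).mulVec (fun j => v j.castSucc) x + v (Fin.last n)) := by
  simp only [symmForms, Finset.forall_mem_image, Finset.mem_univ, forall_const, snoc_dotProduct,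
    one_mul, Prod.forall]
  refine forall₂_congr fun x u => ?_
  rw [show (fun j => (u : ℤ) * Matrix.fromRows A 1 x j) = (u : ℤ) • Matrix.fromRows A 1 x from rfl,
    smul_dotProduct]
  rfl

theorem symmForms_nonneg_iff {A : Matrix m (Fin n) ℤ} (v : Fin (n + 1) → ℤ) :
    (∀ φ ∈ symmForms A, 0 ≤ φ ⬝ᵥ v) ↔
      (fun j => v j.castSucc) ∈ symmPoints A (v (Fin.last n)) := by
  rw [forall_mem_symmForms (P := fun x => 0 ≤ x)]
  simp only [forall_units_int_iff, symmPoints, Set.mem_ofPred_eq, Sum.forall, abs_le]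
  refine and_congr (forall_congr' fun i => ?_) (forall_congr' fun j => ?_)
  · simp only [Matrix.fromRows_mulVec, Sum.elim_inl, Units.val_one, Units.val_neg]
    constructor <;> rintro ⟨h1, h2⟩ <;> constructor <;> linarith
  · simp only [Matrix.fromRows_mulVec, Sum.elim_inr, Units.val_one, Units.val_neg, Matrix.one_mulVec]
    constructor <;> rintro ⟨h1, h2⟩ <;> constructor <;> linarith

/-- By integrality `< k` means `≤ k - 1`: this is where the interior of a dilate becomes the
previous dilate. -/
theorem symmForms_pos_iff {A : Matrix m (Fin n) ℤ} (v : Fin (n + 1) → ℤ) :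
    (∀ φ ∈ symmForms A, 0 < φ ⬝ᵥ v) ↔
      (fun j => v j.castSucc) ∈ symmPoints A (v (Fin.last n) - 1) := by
  rw [forall_mem_symmForms (P := fun x => 0 < x)]
  simp only [forall_units_int_iff, symmPoints, Set.mem_ofPred_eq, Sum.forall, abs_le]
  refine and_congr (forall_congr' fun i => ?_) (forall_congr' fun j => ?_)
  · simp only [Matrix.fromRows_mulVec, Sum.elim_inl, Units.val_one, Units.val_neg]
    constructor <;> rintro ⟨h1, h2⟩ <;> constructor <;> linarith
  · simp only [Matrix.fromRows_mulVec, Sum.elim_inr, Units.val_one, Units.val_neg, Matrix.one_mulVec]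
    constructor <;> rintro ⟨h1, h2⟩ <;> constructor <;> linarith

omit [Fintype m] in
theorem symmPoints_subset_Icc {ι : Type*} [Fintype ι] (A : Matrix m ι ℤ) (k : ℤ) :
    symmPoints A k ⊆ Set.Icc (fun _ => -k) (fun _ => k) :=
  fun _ hz => ⟨fun j => (abs_le.1 (hz.2 j)).1, fun j => (abs_le.1 (hz.2 j)).2⟩

theorem unimodularSystem_symmForms {A : Matrix m (Fin n) ℤ} (hA : A.IsTotallyUnimodular) :
    UnimodularSystem (symmForms A) := by
  refine ⟨fun k f g hf => ?_, fun v hv0 hv => ?_, fun k => ?_⟩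
  · simp only [symmForms, Finset.mem_image, Finset.mem_univ, true_and] at hf
    choose x hx using hf
    have hTU := (Matrix.fromRows_one_isTotallyUnimodular_iff A).2 hA
    rw [Matrix.isTotallyUnimodular_iff] at hTU
    obtain ⟨s, hs⟩ := hTU k (fun i => (x i).1) g
    have : (Matrix.of fun i j => f i (g j).castSucc) = Matrix.of fun i j =>
        ((x i).2 : ℤ) * ((Matrix.fromRows A 1).submatrix (fun i => (x i).1) g) i j := by
      ext i j
      simp [← hx]
    rw [this, Matrix.det_mul_column, ← hs, ← Units.coe_prod]
    rcases Int.units_eq_one_or (∏ i, (x i).2) with h | h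
    · exact ⟨s, by simp [h]⟩
    · exact ⟨-s, by simp [h]⟩
  · rw [symmForms_nonneg_iff, hv0] at hv
    funext i
    refine Fin.lastCases hv0 (fun i => ?_) i
    simpa using hv.2 i
  · refine (Set.finite_Icc (fun _ : Fin (n + 1) => -|k|) (fun _ => |k|)).subset ?_
    rintro v ⟨rfl, hv⟩
    rw [symmForms_nonneg_iff] at hv
    have h := fun i => abs_le.1 ((hv.2 i).trans (le_abs_self _))
    refine ⟨fun i => ?_, fun i => ?_⟩
    · exact Fin.lastCases (neg_abs_le _) (fun i => (h i).1) i
    · exact Fin.lastCases (le_abs_self _) (fun i => (h i).2) i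

/-- Reading the coefficients of a form backwards, for lexicographic comparison from the last
coordinate. -/
def revLex (m : ℕ) : (Fin m → ℤ) →+ Lex (Fin m → ℤ) where
  toFun φ := toLex (φ ∘ Fin.rev)
  map_zero' := rfl
  map_add' _ _ := rfl

theorem revLex_injective (m : ℕ) : Function.Injective (revLex m) := fun a b h => by
  funext i
  simpa using congrFun (toLex.injective h) i.rev

/-- The last coordinate is compared first. All forms in `symmForms` have 1 there, so `revLex` makes
every inequality weak and `-revLex` makes every one strict. -/
theorem revLex_pos {φ : Fin (n + 1) → ℤ} (h : 0 < φ (Fin.last n)) : 0 < revLex (n + 1) φ := by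
  refine ⟨0, fun j hj => absurd hj (Fin.not_lt_zero j), ?_⟩
  change 0 < φ (Fin.rev 0)
  rwa [Fin.rev_zero]

theorem last_eq_one_of_mem_symmForms {A : Matrix m (Fin n) ℤ} {φ : Fin (n + 1) → ℤ}
    (h : φ ∈ symmForms A) : φ (Fin.last n) = 1 := by
  simp only [symmForms, Finset.mem_image] at h
  obtain ⟨x, -, rfl⟩ := h
  simp

theorem mem_halfOpenCone_symmForms {A : Matrix m (Fin n) ℤ} (v : Fin (n + 1) → ℤ) :
    v ∈ halfOpenCone (symmForms A) (revLex (n + 1)) ↔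
      (fun j => v j.castSucc) ∈ symmPoints A (v (Fin.last n)) := by
  rw [← symmForms_nonneg_iff]
  refine forall₂_congr fun φ hφ => ?_
  have hpos := revLex_pos (φ := φ) (by rw [last_eq_one_of_mem_symmForms hφ]; exact one_pos)
  rw [Prod.Lex.le_iff, le_iff_lt_or_eq (b := φ ⬝ᵥ v)]
  exact or_congr Iff.rfl ⟨fun h => h.1, fun h => ⟨h, hpos.le⟩⟩

theorem mem_halfOpenCone_symmForms_neg {A : Matrix m (Fin n) ℤ} (v : Fin (n + 1) → ℤ) :
    v ∈ halfOpenCone (symmForms A) (-revLex (n + 1)) ↔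
      (fun j => v j.castSucc) ∈ symmPoints A (v (Fin.last n) - 1) := by
  rw [← symmForms_pos_iff]
  refine forall₂_congr fun φ hφ => ?_
  have hpos := revLex_pos (φ := φ) (by rw [last_eq_one_of_mem_symmForms hφ]; exact one_pos)
  rw [Prod.Lex.le_iff]
  refine ⟨fun h => h.resolve_right fun h' => ?_, Or.inl⟩
  have h2 : 0 ≤ -revLex (n + 1) φ := h'.2
  exact absurd (neg_nonneg.1 h2) (not_le.2 hpos)

theorem levelSum_one_eq_ncard {Γ : Type*} [AddCommGroup Γ] [LinearOrder Γ]
    {S : Finset (Fin (n + 1) → ℤ)} (hS : UnimodularSystem S) {lam : (Fin (n + 1) → ℤ) →+ Γ}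
    {k : ℤ} {X : Set (Fin n → ℤ)}
    (hX : ∀ v : Fin (n + 1) → ℤ, v (Fin.last n) = k →
      (v ∈ halfOpenCone S lam ↔ (fun j => v j.castSucc) ∈ X)) :
    levelSum S lam (fun _ => 1) k = X.ncard := by
  classical
  have hfin := finite_support_levelSum hS lam k
  have himg : {v | v ∈ halfOpenCone S lam ∧ v (Fin.last n) = k} =
      (fun z => (Fin.snoc z k : Fin (n + 1) → ℤ)) '' X := by
    ext v
    constructor
    · rintro ⟨h1, h2⟩
      refine ⟨fun j => v j.castSucc, (hX v h2).1 h1, ?_⟩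
      rw [← h2]
      exact Fin.snoc_init_self v
    · rintro ⟨z, hz, rfl⟩
      have h2 : (Fin.snoc z k : Fin (n + 1) → ℤ) (Fin.last n) = k := by simp
      exact ⟨(hX _ h2).2 (by simpa using hz), h2⟩
  have hinj : Function.Injective (fun z : Fin n → ℤ => (Fin.snoc z k : Fin (n + 1) → ℤ)) :=
    Fin.snoc_left_injective (α := fun _ => ℤ) k
  rw [← Set.ncard_image_of_injective X hinj, ← himg, Set.ncard_eq_toFinset_card _ hfin]
  unfold levelSum
  rw [finsum_eq_sum_of_support_subset (s := hfin.toFinset)]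
  · rw [Finset.sum_congr rfl fun v hv => if_pos (by simpa using hv)]
    simp
  · intro v hv
    by_contra hv'
    exact hv (if_neg (by simpa using hv'))

end SymmetricPolytopes

/-! ### Ehrhart polynomial of the symmetric polytopes -/

section EhrhartSymmetric

theorem ncard_Icc_pi_int (n k : ℕ) :
    (Set.Icc (fun _ : Fin n => -(k : ℤ)) (fun _ => (k : ℤ))).ncard = (2 * k + 1) ^ n := by
  rw [← Finset.coe_Icc, Set.ncard_coe_finset, Pi.card_Icc]
  simp only [Int.card_Icc, Finset.prod_const, Finset.card_univ, Fintype.card_fin]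
  congr 1
  omega

theorem ncard_symmPoints_le {m : Type*} {n : ℕ} (A : Matrix m (Fin n) ℤ) (k : ℕ) :
    (symmPoints A k).ncard ≤ (2 * k + 1) ^ n := by
  rw [← ncard_Icc_pi_int]
  exact Set.ncard_le_ncard (symmPoints_subset_Icc A k) (Set.finite_Icc _ _)

/-- Entries of `A` are 0 or ±1, so a point of the cube of radius `k` has `|A z| ≤ n * k`. The factor
`n + 1` also covers `n = 0`. -/
theorem le_ncard_symmPoints {m : Type*} {n : ℕ} {A : Matrix m (Fin n) ℤ}
    (hA : A.IsTotallyUnimodular) (k : ℕ) :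
    (2 * k + 1) ^ n ≤ (symmPoints A (((n + 1) * k : ℕ) : ℤ)).ncard := by
  rw [← ncard_Icc_pi_int]
  refine Set.ncard_le_ncard ?_ ((Set.finite_Icc _ _).subset (symmPoints_subset_Icc A _))
  rintro z ⟨hz1, hz2⟩
  have hz : ∀ j, |z j| ≤ k := fun j => abs_le.2 ⟨hz1 j, hz2 j⟩
  have hk : (0 : ℤ) ≤ k := Int.natCast_nonneg k
  refine ⟨fun i => ?_, fun j => (hz j).trans ?_⟩
  · calc |A.mulVec z i| ≤ ∑ j, |A i j * z j| := by
          rw [Matrix.mulVec, dotProduct]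
          exact Finset.abs_sum_le_sum_abs _ _
      _ ≤ ∑ _j : Fin n, (k : ℤ) := by
          refine Finset.sum_le_sum fun j _ => ?_
          rw [abs_mul]
          obtain ⟨s, hs⟩ := hA.apply i j
          have h1 : |A i j| ≤ 1 := by rw [← hs]; cases s <;> simp
          calc |A i j| * |z j| ≤ 1 * |z j| := mul_le_mul_of_nonneg_right h1 (abs_nonneg _)
            _ ≤ k := by rw [one_mul]; exact hz j
      _ = n * k := by simp
      _ ≤ _ := by push_cast; nlinarith
  · push_cast
    nlinarith [mul_nonneg (Int.natCast_nonneg n) hk]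

theorem exists_ehrhart_of_isTotallyUnimodular_fin {m : Type*} [Fintype m] {n : ℕ}
    {A : Matrix m (Fin n) ℤ} (hA : A.IsTotallyUnimodular) :
    ∃ p : Polynomial ℚ, (∀ k : ℕ, 0 < k → p.eval (k : ℚ) = (symmPoints A k).ncard) ∧
      p.natDegree = n ∧ IsPalindromicHStar p := by
  have hS := unimodularSystem_symmForms hA
  obtain ⟨p, hp⟩ := exists_levelSum_polynomial hS (revLex_injective (n + 1)) 1
  have hone : intEval (1 : MvPolynomial (Fin (n + 1)) ℚ) = fun _ => 1 := by
    funext v; simp [intEval]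
  simp only [hone] at hp
  have hval : ∀ k : ℕ, 0 < k → p.eval (k : ℚ) = (symmPoints A k).ncard := by
    intro k hk
    have := (hp k (by exact_mod_cast hk)).1
    rw [Int.cast_natCast] at this
    rw [this]
    exact levelSum_one_eq_ncard hS fun v hv => by rw [mem_halfOpenCone_symmForms, hv]
  have hrec : ∀ k : ℕ, 0 < k → p.eval (-1 - (k : ℚ)) = (-1) ^ n * p.eval (k : ℚ) := by
    intro k hk
    have := (hp (k + 1) (by positivity)).2
    rw [levelSum_one_eq_ncard (X := symmPoints A k) hS fun v hv => by
      rw [mem_halfOpenCone_symmForms_neg, hv, add_sub_cancel_right], ← hval k hk] at this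
    rw [← this]
    congr 1
    push_cast; ring
  have hdeg : p.natDegree = n := by
    refine natDegree_eq_of_growth (a := n + 1) n.succ_pos (fun k hk => ?_) (fun k hk => ?_)
    · rw [hval k hk, abs_of_nonneg (by positivity)]
      exact_mod_cast ncard_symmPoints_le A k
    · rw [hval _ (by positivity), abs_of_nonneg (by positivity)]
      have h1 : k ^ n ≤ (2 * k + 1) ^ n := Nat.pow_le_pow_left (by omega) n
      exact_mod_cast h1.trans (le_ncard_symmPoints hA k)
  refine ⟨p, hval, hdeg, isPalindromicHStar_of_eval_neg fun x => ?_⟩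
  -- Reciprocity is known only at positive integers; infinitely many agreements make it a polynomial
  -- identity.
  have hpoly : p.comp (-1 - Polynomial.X) = Polynomial.C ((-1) ^ n) * p := by
    refine Polynomial.eq_of_infinite_eval_eq _ _ (Set.Infinite.mono ?_
      (Set.infinite_range_of_injective (f := fun k : ℕ => ((k + 1 : ℕ) : ℚ))
        (fun a b h => by simpa using h)))
    rintro _ ⟨k, rfl⟩
    have := hrec (k + 1) k.succ_pos
    simpa [Polynomial.eval_comp] using this
  have := congrArg (Polynomial.eval x) hpoly
  rw [hdeg]
  simpa [Polynomial.eval_comp] using this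

theorem ncard_symmPoints_reindex {m ι κ : Type*} [Fintype ι] [Fintype κ] (e : ι ≃ κ)
    (A : Matrix m ι ℤ) (k : ℤ) :
    (symmPoints (A.submatrix id e.symm) k).ncard = (symmPoints A k).ncard := by
  rw [← Set.ncard_image_of_injective (symmPoints A k) (e.arrowCongr (Equiv.refl ℤ)).injective]
  congr 1
  ext z
  rw [Equiv.image_eq_preimage_symm]
  simp only [symmPoints, Set.mem_preimage, Set.mem_ofPred_eq]
  refine and_congr (forall_congr' fun i => ?_) ?_
  · rw [Matrix.submatrix_mulVec_equiv]
    rfl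
  · rw [← e.forall_congr_right]
    rfl

theorem exists_ehrhart_of_isTotallyUnimodular {m ι : Type*} [Fintype m] [Fintype ι]
    {A : Matrix m ι ℤ} (hA : A.IsTotallyUnimodular) :
    ∃ p : Polynomial ℚ, (∀ k : ℕ, 0 < k → p.eval (k : ℚ) = (symmPoints A k).ncard) ∧
      p.natDegree = Fintype.card ι ∧ IsPalindromicHStar p := by
  obtain ⟨p, h1, h2⟩ := exists_ehrhart_of_isTotallyUnimodular_fin
    (hA.submatrix id (Fintype.equivFin ι).symm)
  simp only [ncard_symmPoints_reindex] at h1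
  exact ⟨p, h1, h2⟩

theorem ehrhartFunction_eq_ncard_symmPoints {m ι : Type*} [Fintype ι] (A : Matrix m ι ℤ)
    {k : ℕ} (hk : 0 < k) :
    ehrhartFunction {x : ι → ℝ | (A.map (Int.cast : ℤ → ℝ)).mulVec x ∈ Set.Icc (-1) 1 ∧
      x ∈ Set.Icc (-1) 1} k = (symmPoints A k).ncard := by
  have hk' : (0 : ℝ) < k := by exact_mod_cast hk
  have habs : ∀ a : ℤ, (-1 ≤ (k : ℝ)⁻¹ * a ∧ (k : ℝ)⁻¹ * a ≤ 1) ↔ |a| ≤ (k : ℤ) := by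
    intro a
    rw [inv_mul_le_iff₀ hk', le_inv_mul_iff₀ hk', abs_le]
    simp only [mul_neg, mul_one]
    exact_mod_cast Iff.rfl
  unfold ehrhartFunction
  congr 1
  ext z
  rw [Set.mem_ofPred_eq, Set.mem_smul_set_iff_inv_smul_mem₀ hk'.ne']
  have hmul : (A.map (Int.cast : ℤ → ℝ)).mulVec (fun j => (z j : ℝ)) =
      fun i => ((A.mulVec z i : ℤ) : ℝ) := by
    funext i
    simp [Matrix.mulVec, dotProduct]
  simp only [symmPoints, Set.mem_ofPred_eq, Matrix.mulVec_smul, hmul, Set.mem_Icc, Pi.le_def,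
    Pi.smul_apply, smul_eq_mul, Pi.neg_apply, Pi.one_apply, ← forall_and, habs]

theorem exists_isEhrhartPolynomial {m ι : Type*} [Fintype m] [Fintype ι]
    {A : Matrix m ι ℤ} (hA : A.IsTotallyUnimodular) :
    ∃ p : Polynomial ℚ, IsEhrhartPolynomial {x : ι → ℝ | (A.map (Int.cast : ℤ → ℝ)).mulVec x ∈
      Set.Icc (-1) 1 ∧ x ∈ Set.Icc (-1) 1} p ∧
      p.natDegree = Fintype.card ι ∧ IsPalindromicHStar p := by
  obtain ⟨p, h1, h2⟩ := exists_ehrhart_of_isTotallyUnimodular hA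
  refine ⟨p, fun k hk => ?_, h2⟩
  rw [h1 k hk, ehrhartFunction_eq_ncard_symmPoints A hk]

end EhrhartSymmetric

/-! ### Total unimodularity of incidence and coefficient matrices -/

section TotallyUnimodular

theorem mul_mem_range_signType {a b : ℤ} (ha : a ∈ Set.range (SignType.cast : SignType → ℤ))
    (hb : b ∈ Set.range (SignType.cast : SignType → ℤ)) :
    a * b ∈ Set.range (SignType.cast : SignType → ℤ) := by
  obtain ⟨s, rfl⟩ := ha
  obtain ⟨t, rfl⟩ := hb
  exact ⟨s * t, by cases s <;> cases t <;> rfl⟩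

theorem neg_one_pow_mem_range_signType (k : ℕ) :
    (-1 : ℤ) ^ k ∈ Set.range (SignType.cast : SignType → ℤ) := by
  rcases neg_one_pow_eq_or ℤ k with h | h
  · exact ⟨1, by simp [h]⟩
  · exact ⟨-1, by simp [h]⟩

theorem Matrix.IsTotallyUnimodular.neg {m n : Type*} {A : Matrix m n ℤ}
    (hA : A.IsTotallyUnimodular) : (-A).IsTotallyUnimodular := by
  intro k f g hf hg
  rw [show (-A).submatrix f g = -A.submatrix f g from rfl, Matrix.det_neg]
  exact mul_mem_range_signType (neg_one_pow_mem_range_signType _) (hA k f g hf hg)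

open Classical in
/-- The vertex-edge incidence matrix of the edges `tail e → head e`. -/
noncomputable def incidence {V E : Type*} (head tail : E → V) : Matrix V E ℤ :=
  Matrix.of fun v e => (if v = head e then 1 else 0) - (if v = tail e then 1 else 0)

theorem incidence_mem_range_signType {V E : Type*} (head tail : E → V) (v : V) (e : E) :
    incidence head tail v e ∈ Set.range (SignType.cast : SignType → ℤ) := by
  simp only [incidence, Matrix.of_apply]
  split_ifs
  · exact ⟨0, by simp⟩
  · exact ⟨1, by simp⟩
  · exact ⟨-1, by simp⟩
  · exact ⟨0, by simp⟩

/-- If every chosen edge has both ends among the chosen vertices, the rows sum to zero. Otherwise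
some column has at most one nonzero entry, and the determinant is expanded along it. -/
theorem incidence_isTotallyUnimodular {V E : Type*} (head tail : E → V) :
    (incidence head tail).IsTotallyUnimodular := by
  classical
  intro k
  induction k with
  | zero => intro f g _ _; exact ⟨1, by simp⟩
  | succ k ih =>
    intro f g hf hg
    by_cases hall : ∀ j, head (g j) ∈ Set.range f ∧ tail (g j) ∈ Set.range f
    · refine ⟨0, ?_⟩
      rw [SignType.coe_zero, eq_comm, ← Matrix.exists_vecMul_eq_zero_iff]
      refine ⟨1, one_ne_zero, ?_⟩
      funext j
      obtain ⟨⟨a, ha⟩, ⟨b, hb⟩⟩ := hall j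
      simp [Matrix.vecMul, dotProduct, incidence, Finset.sum_sub_distrib, ← ha, ← hb, hf.eq_iff]
    · push Not at hall
      obtain ⟨j, hj⟩ := hall
      obtain ⟨i, hi⟩ : ∃ i, ∀ i', i' ≠ i → incidence head tail (f i') (g j) = 0 := by
        by_cases hh : head (g j) ∈ Set.range f
        · obtain ⟨a, ha⟩ := hh
          refine ⟨a, fun i' hi' => ?_⟩
          have h1 : f i' ≠ head (g j) := fun h => hi' (hf (h.trans ha.symm))
          have h2 : f i' ≠ tail (g j) := fun h => hj ⟨a, ha⟩ ⟨i', h⟩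
          simp [incidence, h1, h2]
        · by_cases ht : tail (g j) ∈ Set.range f
          · obtain ⟨a, ha⟩ := ht
            refine ⟨a, fun i' hi' => ?_⟩
            have h1 : f i' ≠ head (g j) := fun h => hh ⟨i', h⟩
            have h2 : f i' ≠ tail (g j) := fun h => hi' (hf (h.trans ha.symm))
            simp [incidence, h1, h2]
          · refine ⟨0, fun i' _ => ?_⟩
            have h1 : f i' ≠ head (g j) := fun h => hh ⟨i', h⟩
            have h2 : f i' ≠ tail (g j) := fun h => ht ⟨i', h⟩
            simp [incidence, h1, h2]
      rw [Matrix.det_succ_column _ j, Finset.sum_eq_single i]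
      · refine mul_mem_range_signType (mul_mem_range_signType (neg_one_pow_mem_range_signType _)
          (incidence_mem_range_signType head tail _ _)) ?_
        rw [Matrix.submatrix_submatrix]
        exact ih _ _ (hf.comp Fin.succAbove_right_injective) (hg.comp Fin.succAbove_right_injective)
      · intro i' _ hi'
        rw [Matrix.submatrix_apply, hi i' hi']; ring
      · simp

/-- A left invertible matrix has rows spanning the whole space, so some of them form a basis. -/
theorem exists_det_submatrix_ne_zero {V T : Type*} [Fintype V] [Fintype T] [DecidableEq T]
    {M : Matrix V T ℤ} {K : Matrix T V ℤ} (hK : K * M = 1) :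
    ∃ r : T → V, (M.submatrix r id).det ≠ 0 := by
  set v : V → T → ℚ := fun i t => (M i t : ℚ) with hv
  obtain ⟨κ, a, ha, hspan, hli⟩ := exists_linearIndependent' ℚ v
  have htop : Submodule.span ℚ (Set.range (v ∘ a)) = ⊤ := by
    rw [hspan, eq_top_iff, ← (Pi.basisFun ℚ T).span_eq, Submodule.span_le]
    rintro _ ⟨t, rfl⟩
    have : Pi.basisFun ℚ T t = ∑ i, (K t i : ℚ) • v i := by
      funext t'
      have h := congrFun (congrFun hK t) t'
      rw [Matrix.mul_apply] at h
      have h' : ∑ i, (K t i : ℚ) * (M i t' : ℚ) = ((1 : Matrix T T ℤ) t t' : ℚ) := by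
        rw [← h]; push_cast; rfl
      rw [Pi.basisFun_apply, Finset.sum_apply]
      simp only [Pi.smul_apply, smul_eq_mul, hv]
      rw [h', Matrix.one_apply, Pi.single_apply]
      simp [eq_comm]
    rw [this]
    exact Submodule.sum_mem _ fun i _ => Submodule.smul_mem _ _ (Submodule.subset_span ⟨i, rfl⟩)
  let b : Module.Basis κ ℚ (T → ℚ) := Module.Basis.mk hli htop.ge
  let e : T ≃ κ := (Pi.basisFun ℚ T).indexEquiv b
  refine ⟨a ∘ e, fun hdet => ?_⟩
  have hli' : LinearIndependent ℚ ((v ∘ a) ∘ e) := hli.comp e e.injective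
  have hunit := Matrix.linearIndependent_rows_iff_isUnit (A := Matrix.of ((v ∘ a) ∘ e)) |>.1 hli'
  rw [Matrix.isUnit_iff_isUnit_det, isUnit_iff_ne_zero] at hunit
  apply hunit
  have hmap : Matrix.of ((v ∘ a) ∘ e) = (M.submatrix (a ∘ e) id).map (Int.castRingHom ℚ) := by
    ext i j; rfl
  rw [hmap, ← RingHom.mapMatrix_apply, ← RingHom.map_det, hdet, map_zero]

/-- Left multiplication by an invertible row selection of `M` carries `[1 | C]` to rows of `[M |
N]`. Its determinant is nonzero and a minor, hence ±1, so it can be cancelled. -/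
theorem det_mem_range_of_mul_eq {V T κ : Type*} [Fintype V] [Fintype T] [DecidableEq T]
    {M : Matrix V T ℤ} {K : Matrix T V ℤ} (hK : K * M = 1) {N : Matrix V κ ℤ}
    (hTU : (Matrix.fromCols M N).IsTotallyUnimodular) {C : Matrix T κ ℤ} (hC : M * C = N)
    (g : T → T ⊕ κ) :
    ((Matrix.fromCols 1 C).submatrix id g).det ∈ Set.range (SignType.cast : SignType → ℤ) := by
  obtain ⟨r, hr⟩ := exists_det_submatrix_ne_zero hK
  have hTU' := (Matrix.isTotallyUnimodular_iff_fintype _).1 hTU T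
  have hmul : M * Matrix.fromCols 1 C = Matrix.fromCols M N := by
    rw [Matrix.mul_fromCols, hC, Matrix.mul_one]
  have hdet : (M.submatrix r id).det * ((Matrix.fromCols 1 C).submatrix id g).det =
      ((Matrix.fromCols M N).submatrix r g).det := by
    rw [← Matrix.det_mul, ← hmul]
    rfl
  have h1 := hTU' r g
  obtain ⟨s, hs⟩ : (M.submatrix r id).det ∈ Set.range (SignType.cast : SignType → ℤ) :=
    hTU' r Sum.inl
  rw [← hdet] at h1
  have hsq : (M.submatrix r id).det * (M.submatrix r id).det = 1 := by
    rw [← hs] at hr ⊢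
    cases s <;> simp at hr ⊢
  have h2 := mul_mem_range_signType ⟨s, hs⟩ h1
  rwa [← mul_assoc, hsq, one_mul] at h2

/-- If the columns of `N` are expressed through the columns of a left invertible matrix `M` and
`[M | N]` is totally unimodular, then so is the matrix of coefficients. -/
theorem isTotallyUnimodular_of_mul_eq {V T κ : Type*} [Fintype V] [Fintype T] [DecidableEq T]
    {M : Matrix V T ℤ} {K : Matrix T V ℤ} (hK : K * M = 1) {N : Matrix V κ ℤ}
    (hTU : (Matrix.fromCols M N).IsTotallyUnimodular) {C : Matrix T κ ℤ} (hC : M * C = N) :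
    C.IsTotallyUnimodular := by
  classical
  intro k f h hf _
  let e : Fin k ⊕ ((Set.range f)ᶜ : Set T) ≃ T :=
    ((Equiv.ofInjective f hf).sumCongr (Equiv.refl _)).trans (Equiv.Set.sumCompl (Set.range f))
  let g : Fin k ⊕ ((Set.range f)ᶜ : Set T) → T ⊕ κ := Sum.elim (Sum.inr ∘ h) (fun t => Sum.inl t.1)
  -- The minor of `C` is completed by the unit columns of the unused rows to a maximal minor of `[1
  -- | C]`, which is block triangular with the same determinant.
  have hfull := det_mem_range_of_mul_eq hK hTU hC (g ∘ e.symm)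
  rw [← Matrix.det_submatrix_equiv_self e, Matrix.submatrix_submatrix] at hfull
  have hblock : (Matrix.fromCols 1 C).submatrix (id ∘ e) ((g ∘ e.symm) ∘ e) =
      Matrix.fromBlocks (C.submatrix f h) 0
        (C.submatrix (fun t : ((Set.range f)ᶜ : Set T) => t.1) h) 1 := by
    ext i j
    have hl : ∀ i, e (Sum.inl i) = f i := fun i => rfl
    have hr : ∀ t, e (Sum.inr t) = t.1 := fun t => rfl
    simp only [Matrix.submatrix_apply, Function.comp, Equiv.symm_apply_apply, id]
    rcases i with i | i <;> rcases j with j | j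
    · simp [g, hl]
    · have : f i ≠ j.1 := fun h' => j.2 ⟨i, h'⟩
      simp [g, hl, this]
    · simp [g, hr]
    · simp [g, hr, Matrix.one_apply, Subtype.ext_iff]
  rw [hblock, Matrix.det_fromBlocks_zero₁₂, Matrix.det_one, mul_one] at hfull
  exact hfull

end TotallyUnimodular

namespace DirMultigraph

/-! ### Walks, paths and their signed edge vectors -/

section Walks

variable {V E : Type*} (G : DirMultigraph V E)

theorem IsWalk.append {G : DirMultigraph V E} {u v w : V} {l l' : List (E × Bool)}
    (h : G.IsWalk u l v) (h' : G.IsWalk v l' w) : G.IsWalk u (l ++ l') w := by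
  induction l generalizing u with
  | nil => obtain rfl : u = v := h; exact h'
  | cons s l ih => exact ⟨h.1, ih h.2⟩

/-- `v` can be reached from `u` along edges of `S`. -/
def Reaches (S : Set E) (u v : V) : Prop := ∃ l, G.IsWalk u l v ∧ ∀ s ∈ l, s.1 ∈ S

theorem Reaches.refl (S : Set E) (u : V) : G.Reaches S u u := ⟨[], rfl, by simp⟩

theorem Reaches.step {G : DirMultigraph V E} {S : Set E} {u v : V} (h : G.Reaches S u v)
    {s : E × Bool} (hs : s.1 ∈ S) (hv : G.stepSource s = v) : G.Reaches S u (G.stepTarget s) := by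
  obtain ⟨l, hl, hlS⟩ := h
  refine ⟨l ++ [s], hl.append ⟨hv, rfl⟩, fun s' hs' => ?_⟩
  rcases List.mem_append.1 hs' with h | h
  · exact hlS _ h
  · rwa [List.mem_singleton.1 h]

theorem reaches_head_iff_tail {S : Set E} {u : V} {e : E} (he : e ∈ S) :
    G.Reaches S u (G.head e) ↔ G.Reaches S u (G.tail e) :=
  ⟨fun h => h.step (s := (e, false)) he rfl, fun h => h.step (s := (e, true)) he rfl⟩

theorem IsPath.suffix {G : DirMultigraph V E} {u v w : V} {l : List (E × Bool)}
    (h : G.IsPath w l v) (hu : u ∈ w :: l.map G.stepTarget) :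
    ∃ l', G.IsPath u l' v ∧ ∀ s ∈ l', s ∈ l := by
  induction l generalizing w with
  | nil =>
    obtain rfl : u = w := by simpa using hu
    exact ⟨[], h, by simp⟩
  | cons s l ih =>
    rcases List.mem_cons.1 hu with rfl | hu
    · exact ⟨_, h, fun _ hs => hs⟩
    · obtain ⟨l', h1, h2⟩ := ih ⟨h.1.2, (List.nodup_cons.1 h.2).2⟩ hu
      exact ⟨l', h1, fun s' hs' => List.mem_cons_of_mem _ (h2 s' hs')⟩

theorem Reaches.exists_isPath {G : DirMultigraph V E} {S : Set E} {u v : V}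
    (h : G.Reaches S u v) : ∃ l, G.IsPath u l v ∧ ∀ s ∈ l, s.1 ∈ S := by
  obtain ⟨l, hl, hlS⟩ := h
  induction l generalizing u with
  | nil => exact ⟨[], ⟨hl, by simp⟩, by simp⟩
  | cons s l ih =>
    obtain ⟨l', h1, h2⟩ := ih hl.2 fun s' hs' => hlS s' (List.mem_cons_of_mem _ hs')
    by_cases hu : u ∈ G.stepTarget s :: l'.map G.stepTarget
    · obtain ⟨l'', h3, h4⟩ := h1.suffix hu
      exact ⟨l'', h3, fun s' hs' => h2 s' (h4 s' hs')⟩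
    · refine ⟨s :: l', ⟨⟨hl.1, h1.1⟩, List.nodup_cons.2 ⟨hu, h1.2⟩⟩, fun s' hs' => ?_⟩
      rcases List.mem_cons.1 hs' with rfl | hs'
      · exact hlS _ List.mem_cons_self
      · exact h2 s' hs'

/-- Using an edge again would end at one of its two ends, both already visited. -/
theorem IsPath.nodup_edges {G : DirMultigraph V E} {u v : V} {l : List (E × Bool)}
    (h : G.IsPath u l v) : (l.map Prod.fst).Nodup := by
  induction l generalizing u with
  | nil => simp
  | cons s l ih =>
    obtain ⟨⟨hsrc, hw⟩, hnd⟩ := h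
    rw [List.map_cons, List.nodup_cons] at hnd
    refine List.nodup_cons.2 ⟨fun hmem => ?_, ih ⟨hw, hnd.2⟩⟩
    obtain ⟨s', hs', hfst⟩ := List.mem_map.1 hmem
    have ht : G.stepTarget s' ∈ l.map G.stepTarget := List.mem_map_of_mem hs'
    have hcase : G.stepTarget s' = G.stepTarget s ∨ G.stepTarget s' = G.stepSource s := by
      obtain ⟨a, b⟩ := s
      obtain ⟨a', b'⟩ := s'
      obtain rfl : a' = a := hfst
      cases b <;> cases b' <;> simp [stepTarget, stepSource]
    rcases hcase with h | h
    · rw [h] at ht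
      exact (List.nodup_cons.1 hnd.2).1 ht
    · rw [h, hsrc] at ht
      exact hnd.1 (List.mem_cons_of_mem _ ht)

variable [DecidableEq E]

/-- The signed edge vector of a single step. -/
def stepVector (s : E × Bool) : E → ℤ := Pi.single s.1 (if s.2 then 1 else -1)

theorem signVector_eq_sum {l : List (E × Bool)} (h : (l.map Prod.fst).Nodup) (e : E) :
    signVector l e = (((l.map stepVector).sum e : ℤ) : ℝ) := by
  induction l with
  | nil => simp [signVector]
  | cons s l ih =>
    rw [List.map_cons, List.nodup_cons] at h
    obtain ⟨a, b⟩ := s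
    have ih' := ih h.2
    rw [List.map_cons, List.sum_cons, Pi.add_apply, Int.cast_add, ← ih', stepVector]
    by_cases hae : e = a
    · subst hae
      have hn : ∀ b', (e, b') ∉ l := fun b' hb' => h.1 (List.mem_map.2 ⟨_, hb', rfl⟩)
      cases b <;> simp [signVector, hn]
    · simp [signVector, hae]

variable [Fintype E]

theorem sum_incidence_mul_stepVector (s : E × Bool) (y : V → ℤ) :
    ∑ e, (y (G.head e) - y (G.tail e)) * stepVector s e =
      y (G.stepTarget s) - y (G.stepSource s) := by
  obtain ⟨a, b⟩ := s
  rw [Finset.sum_eq_single a]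
  · cases b <;> simp [stepVector, stepTarget, stepSource]
  · intro e _ he
    simp [stepVector, he]
  · simp

/-- The differences of a potential `y` telescope along a walk. Indicator functions as `y` give the
boundary of a path and the crossings of a cut. -/
theorem IsWalk.sum_mul {G : DirMultigraph V E} {u v : V} {l : List (E × Bool)}
    (h : G.IsWalk u l v) (y : V → ℤ) :
    ∑ e, (y (G.head e) - y (G.tail e)) * (l.map stepVector).sum e = y v - y u := by
  induction l generalizing u with
  | nil => obtain rfl : u = v := h; simp
  | cons s l ih =>
    simp only [List.map_cons, List.sum_cons, Pi.add_apply, mul_add, Finset.sum_add_distrib]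
    rw [ih h.2, sum_incidence_mul_stepVector, h.1]
    ring

end Walks

/-! ### Spanning forests, fundamental cuts and the matrix `C` -/

section Forests

variable {V E : Type*} {G : DirMultigraph V E}

theorem sum_mul_incidence [Fintype V] (y : V → ℤ) (e : E) :
    ∑ v, y v * incidence G.head G.tail v e = y (G.head e) - y (G.tail e) := by
  classical
  simp [incidence, mul_sub, Finset.sum_sub_distrib]

theorem IsCycleFree.not_reaches {T : Finset E} (hT : G.IsCycleFree T) {t : E} (ht : t ∈ T) :
    ¬ G.Reaches ((T : Set E) \ {t}) (G.head t) (G.tail t) := by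
  intro h
  obtain ⟨l, hl, hlS⟩ := h.exists_isPath
  refine hT ((t, true) :: l) (fun s hs => ?_) ⟨by simp, ⟨G.tail t, rfl, hl.1⟩, ?_, hl.2⟩
  · rcases List.mem_cons.1 hs with rfl | hs
    · exact ht
    · exact (hlS s hs).1
  · refine List.nodup_cons.2 ⟨fun hmem => ?_, hl.nodup_edges⟩
    obtain ⟨s, hs, hst⟩ := List.mem_map.1 hmem
    exact (hlS s hs).2 hst

theorem signVector_ne_zero_of_mem [DecidableEq E] {l : List (E × Bool)} {e : E}
    (h : e ∈ l.map Prod.fst) : signVector l e ≠ 0 := by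
  obtain ⟨⟨a, b⟩, hs, rfl⟩ := List.mem_map.1 h
  unfold signVector
  cases b <;> split_ifs <;> simp_all

theorem signVector_eq_zero_of_notMem [DecidableEq E] {l : List (E × Bool)} {e : E}
    (h : e ∉ l.map Prod.fst) : signVector l e = 0 := by
  have hn : ∀ b, (e, b) ∉ l := fun b hb => h (List.mem_map.2 ⟨_, hb, rfl⟩)
  simp [signVector, hn]

theorem IsSpanningForest.reaches [Fintype E] [DecidableEq E] {T : Finset E}
    (hT : G.IsSpanningForest T) {e : E} (he : e ∉ T) :
    G.Reaches (T : Set E) (G.head e) (G.tail e) := by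
  classical
  by_contra hcon
  refine he (hT.2 (y := insert e T) (fun l hl hcyc => ?_) (Finset.subset_insert _ _)
    (Finset.mem_insert_self _ _))
  by_cases hmem : e ∈ l.map Prod.fst
  · obtain ⟨-, ⟨u, hu⟩, hnd, -⟩ := hcyc
    -- The potential is the indicator of the `T`-component of the head of `e`. It changes only
    -- across `e`, so a closed walk in `T ∪ {e}` has net coefficient 0 at `e`, whereas a cycle
    -- through `e` uses it exactly once.
    have hsum := hu.sum_mul (fun v => if G.Reaches (T : Set E) (G.head e) v then 1 else 0)
    rw [sub_self, Finset.sum_eq_single e] at hsum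
    · rw [if_pos (Reaches.refl G _ _), if_neg hcon, sub_zero, one_mul] at hsum
      apply signVector_ne_zero_of_mem hmem
      rw [signVector_eq_sum hnd, hsum, Int.cast_zero]
    · intro e' _ he'
      by_cases he'T : e' ∈ T
      · rw [if_congr (G.reaches_head_iff_tail (Finset.mem_coe.2 he'T)) rfl rfl, sub_self, zero_mul]
      · have hn : e' ∉ l.map Prod.fst := fun h => by
          obtain ⟨s, hs, rfl⟩ := List.mem_map.1 h
          rcases Finset.mem_insert.1 (hl s hs) with h | h
          · exact he' h
          · exact he'T h
        have := signVector_eq_zero_of_notMem hn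
        rw [signVector_eq_sum hnd, Int.cast_eq_zero] at this
        rw [this, mul_zero]
    · simp
  · refine hT.1 l (fun s hs => ?_) hcyc
    rcases Finset.mem_insert.1 (hl s hs) with h | h
    · exact absurd (List.mem_map.2 ⟨s, hs, h⟩) hmem
    · exact h

theorem IsSpanningForest.forestPath_spec [Fintype E] [DecidableEq E] {T : Finset E}
    (hT : G.IsSpanningForest T) {e : E} (he : e ∉ T) :
    G.IsPath (G.head e) (G.forestPath T (G.head e) (G.tail e)) (G.tail e) ∧
      ∀ s ∈ G.forestPath T (G.head e) (G.tail e), s.1 ∈ T := by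
  have h : ∃ l, G.IsPath (G.head e) l (G.tail e) ∧ ∀ s ∈ l, s.1 ∈ T :=
    (hT.reaches he).exists_isPath
  rw [forestPath, dif_pos h]
  exact h.choose_spec

/-- The integral version of `forestMatrix`. -/
noncomputable def intForestMatrix [DecidableEq E] (G : DirMultigraph V E) (T : Finset E) :
    Matrix {e // e ∈ T} {e // e ∉ T} ℤ :=
  Matrix.of fun a e => ((G.forestPath T (G.head e.1) (G.tail e.1)).map stepVector).sum a.1

variable [Fintype E] [DecidableEq E] {T : Finset E}

theorem IsSpanningForest.forestMatrix_eq (hT : G.IsSpanningForest T) :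
    G.forestMatrix T = (G.intForestMatrix T).map (Int.cast : ℤ → ℝ) := by
  ext a e
  exact signVector_eq_sum (hT.forestPath_spec e.2).1.nodup_edges a.1

/-- The forest path runs from head to tail, so its boundary is minus the incidence column of `e`.
This is the source of the sign. -/
theorem IsSpanningForest.incidence_mul (hT : G.IsSpanningForest T) :
    (incidence G.head G.tail).submatrix id (Subtype.val : {e // e ∈ T} → E) *
      -G.intForestMatrix T =
      (incidence G.head G.tail).submatrix id (Subtype.val : {e // e ∉ T} → E) := by
  classical
  ext v e
  obtain ⟨hp, hpT⟩ := hT.forestPath_spec e.2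
  have h := hp.1.sum_mul (fun w => if v = w then 1 else 0)
  have hsplit := Fintype.sum_subtype_add_sum_subtype (fun e => e ∈ T) (fun e' =>
    incidence G.head G.tail v e' *
      ((G.forestPath T (G.head e.1) (G.tail e.1)).map stepVector).sum e')
  have hzero : ∑ i : {e' // e' ∉ T}, incidence G.head G.tail v i.1 *
      ((G.forestPath T (G.head e.1) (G.tail e.1)).map stepVector).sum i.1 = 0 := by
    refine Finset.sum_eq_zero fun i _ => ?_
    have hn : i.1 ∉ (G.forestPath T (G.head e.1) (G.tail e.1)).map Prod.fst := fun hmem => by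
      obtain ⟨s, hs, hsi⟩ := List.mem_map.1 hmem
      exact i.2 (hsi ▸ hpT s hs)
    have := signVector_eq_zero_of_notMem hn
    rw [signVector_eq_sum hp.nodup_edges, Int.cast_eq_zero] at this
    rw [this, mul_zero]
  rw [hzero, add_zero] at hsplit
  rw [Matrix.mul_neg, Matrix.neg_apply, Matrix.mul_apply]
  simp only [Matrix.submatrix_apply, id, intForestMatrix, Matrix.of_apply]
  refine (congrArg Neg.neg (Eq.trans ?_ (hsplit.trans h))).trans ?_
  · exact Finset.sum_congr (by ext; simp) fun _ _ => rfl
  · simp [incidence]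

omit [Fintype E] in
theorem IsCycleFree.exists_leftInverse [Fintype V] (hT : G.IsCycleFree T) :
    ∃ K : Matrix {e // e ∈ T} V ℤ,
      K * (incidence G.head G.tail).submatrix id (Subtype.val : {e // e ∈ T} → E) = 1 := by
  classical
  -- Row `t` is the indicator of the side of the fundamental cut of `t` containing its head: among
  -- forest edges only `t` crosses it.
  refine ⟨Matrix.of fun t v => if G.Reaches ((T : Set E) \ {t.1}) (G.head t.1) v then 1 else 0, ?_⟩
  ext t t'
  rw [Matrix.mul_apply]
  simp only [Matrix.of_apply, Matrix.submatrix_apply, id]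
  rw [sum_mul_incidence (fun v => if G.Reaches ((T : Set E) \ {t.1}) (G.head t.1) v then 1 else 0)]
  by_cases h : t = t'
  · subst h
    rw [if_pos (Reaches.refl G _ _), if_neg (hT.not_reaches t.2), Matrix.one_apply_eq, sub_zero]
  · have hmem : t'.1 ∈ (T : Set E) \ {t.1} := ⟨t'.2, fun h' => h (Subtype.ext h'.symm)⟩
    rw [if_congr (G.reaches_head_iff_tail hmem) rfl rfl, Matrix.one_apply_ne h, sub_self]

theorem IsSpanningForest.neg_intForestMatrix_isTotallyUnimodular [Fintype V]
    (hT : G.IsSpanningForest T) : (-G.intForestMatrix T).IsTotallyUnimodular := by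
  obtain ⟨K, hK⟩ := IsCycleFree.exists_leftInverse hT.1
  refine isTotallyUnimodular_of_mul_eq hK ?_ hT.incidence_mul
  have : Matrix.fromCols ((incidence G.head G.tail).submatrix id (Subtype.val : {e // e ∈ T} → E))
      ((incidence G.head G.tail).submatrix id (Subtype.val : {e // e ∉ T} → E)) =
      (incidence G.head G.tail).submatrix id (Sum.elim Subtype.val Subtype.val) := by
    ext v e
    rcases e with e | e <;> rfl
  rw [this]
  exact (incidence_isTotallyUnimodular _ _).submatrix _ _

end Forests

end DirMultigraph

theorem mainTheorem7 {V E : Type*} [Fintype V] [Fintype E] [DecidableEq E]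
    (G : DirMultigraph V E) (T : Finset E) (hT : G.IsSpanningForest T) :
    (∃ p : Polynomial ℚ, IsEhrhartPolynomial (G.flowPolytope T) p ∧
      p.natDegree = Fintype.card {e // e ∉ T} ∧ IsPalindromicHStar p) ∧
    (∃ p : Polynomial ℚ, IsEhrhartPolynomial (G.tensionPolytope T) p ∧
      p.natDegree = Fintype.card {e // e ∈ T} ∧ IsPalindromicHStar p) := by
  have hTU := hT.neg_intForestMatrix_isTotallyUnimodular
  constructor
  · have h := exists_isEhrhartPolynomial hTU
    have hmat : (-G.intForestMatrix T).map (Int.cast : ℤ → ℝ) = -G.forestMatrix T := by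
      rw [hT.forestMatrix_eq]
      ext a e
      simp
    rw [hmat] at h
    exact h
  · have hTU' : (G.intForestMatrix T).transpose.IsTotallyUnimodular := by
      have := hTU.neg
      rw [neg_neg] at this
      exact this.transpose
    have h := exists_isEhrhartPolynomial hTU'
    have hmat : (G.intForestMatrix T).transpose.map (Int.cast : ℤ → ℝ) =
        (G.forestMatrix T).transpose := by
      rw [hT.forestMatrix_eq]
      rfl
    rw [hmat] at h
    exact h
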